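/- Let $\mathbb R_+$ be the set of nonnegative reals with the operations $a\oplus b=\max(a,b)$ and $a\otimes b=ab$; matrix products, powers $A^t$ ($A^0=I$) and matrix-vector products are taken over this semiring. For $A\in\mathbb R_+^{n\times n}$ let $D(A)$ be the digraph on $\{1,\dots,n\}$ with edges $(i,j)$, $a_{ij}\ne 0$. A cycle of $D(A)$ is a closed path with at least one edge, its weight is the product of the entries $a_{ij}$ along it, and its geometric mean is the $k$-th root of its weight, $k$ being its number of edges. For each strongly connected component of $D(A)$, its critical digraph consists of the nodes and edges on those cycles in the component whose geometric mean is the largest one in this component (it is empty if the component has no cycle). The cyclicity of a strongly connected digraph is the greatest common divisor of the lengths of its simple cycles. Let $\gamma\ge 1$ be the least common multiple of the cyclicities of all strongly connected components of the critical digraphs of all components of $D(A)$ ($\gamma=1$ if $D(A)$ is acyclic). The matrix $A$ is called orbit periodic if for each $y\in\mathbb R_+^n$ there is $\lambda(y)\in\mathbb R_+$ such that $A^{t+\gamma}\otimes y=\lambda(y)^{\gamma}\,(A^t\otimes y)$ for all sufficiently large $t$ (here $\lambda(y)^\gamma$ is the usual power of the number $\lambda(y)$). **Corollary.** Given $A\in\mathbb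 R_+^{n\times n}$, it takes no more than $O(n^4\log n)$ operations to verify whether $A$ is orbit periodic or not. That is, there are a single program $P$ and a constant $K$ such that for all $n\ge 0$ and all $A\in\mathbb R_+^{n\times n}$, the program $P$, given $n$ and $A$, stops with the correct answer to the question whether $A$ is orbit periodic, and for $n\ge 2$ it does so after at most $K n^4\log n$ operations. Programs are built by sequencing, if-then-else and while loops for a random access machine with index registers and with two-dimensional arrays of natural numbers and of nonnegative reals, whose entries are addressed by index registers. Each of the following counts as one operation: setting an index register to $0$, changing it by $\pm1$ (decrementing $0$ gives $0$), copying it, moving a natural number between a register and an array entry, testing $=$ or $<$ between index registers; setting a real array entry to $0$ or $1$, copying it, the product or the maximum of two real entries, testing $\le$ between two real entries. -/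

import Mathlib

open scoped NNReal

namespace MaxAlg

/-! ### Max algebra over the nonnegative reals

In `ℝ≥0` the supremum over a finite index set is the maximum, and it is `0` (the zero of the
semiring) over the empty set. -/

section Algebra

variable {n : ℕ}

/-- Max-algebraic matrix product, `(A ⊗ B) i j = max_k A i k * B k j`. -/
noncomputable def mul (A B : Matrix (Fin n) (Fin n) ℝ≥0) : Matrix (Fin n) (Fin n) ℝ≥0 :=
  fun i j => Finset.univ.sup fun k => A i k * B k j

/-- Max-algebraic powers, starting from the identity matrix. -/
noncomputable def pow (A : Matrix (Fin n) (Fin n) ℝ≥0) : ℕ → Matrix (Fin n) (Fin n) ℝ≥0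
  | 0 => 1
  | t + 1 => mul (pow A t) A

/-- Max-algebraic product of a matrix and a vector, `(A ⊗ y) i = max_j A i j * y j`. -/
noncomputable def mulVec (A : Matrix (Fin n) (Fin n) ℝ≥0) (y : Fin n → ℝ≥0) : Fin n → ℝ≥0 :=
  fun i => Finset.univ.sup fun j => A i j * y j

/-! ### Associated digraph, maximum cycle geometric mean, critical digraph -/

/-- Edges of the digraph associated with `A`. -/
def Edge (A : Matrix (Fin n) (Fin n) ℝ≥0) (i j : Fin n) : Prop := A i j ≠ 0

/-- `c 0, c 1, …, c k = c 0` is a cycle (closed path) with `k ≥ 1` edges in the digraph whose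
edge relation is `E`. Repeated nodes are allowed; values of `c` beyond `k` are irrelevant. -/
def IsCycle (E : Fin n → Fin n → Prop) (k : ℕ) (c : ℕ → Fin n) : Prop :=
  0 < k ∧ c k = c 0 ∧ ∀ t < k, E (c t) (c (t + 1))

/-- Weight of the path `c 0, c 1, …, c k`. -/
noncomputable def weight (A : Matrix (Fin n) (Fin n) ℝ≥0) (k : ℕ) (c : ℕ → Fin n) : ℝ≥0 :=
  ∏ t ∈ Finset.range k, A (c t) (c (t + 1))

/-- The geometric mean `w(c)^(1/k)` of a cycle with `k` edges. -/
noncomputable def geomMean (A : Matrix (Fin n) (Fin n) ℝ≥0) (k : ℕ) (c : ℕ → Fin n) : ℝ≥0 :=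
  weight A k c ^ (1 / (k : ℝ))

/-- Maximum cycle geometric mean: the maximum over the cycles with at most `n` edges. These have
finitely many geometric means, so the supremum is a maximum; it is `0` if there is no cycle. -/
noncomputable def mcgm (A : Matrix (Fin n) (Fin n) ℝ≥0) : ℝ≥0 :=
  sSup {x | ∃ k c, k ≤ n ∧ IsCycle (Edge A) k c ∧ x = geomMean A k c}

/-- Edges of the critical digraph of `A`: the edges on cycles that attain the maximum cycle
geometric mean. -/
def CritEdge (A : Matrix (Fin n) (Fin n) ℝ≥0) (i j : Fin n) : Prop :=
  ∃ k c, IsCycle (Edge A) k c ∧ geomMean A k c = mcgm A ∧ ∃ t < k, c t = i ∧ c (t + 1) = j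

/-- `i` and `j` lie in the same strongly connected component of the digraph `E`. -/
def SameComp (E : Fin n → Fin n → Prop) (i j : Fin n) : Prop :=
  Relation.ReflTransGen E i j ∧ Relation.ReflTransGen E j i

open Classical in
/-- Cyclicity of the strongly connected component of the node `i` in the digraph `E`: the g.c.d.
of the lengths of its simple cycles (a simple cycle has at most `n` edges). -/
noncomputable def compCyclicity (E : Fin n → Fin n → Prop) (i : Fin n) : ℕ :=
  ((Finset.Icc 1 n).filter fun k =>
    ∃ c, IsCycle E k c ∧ Set.InjOn c (Set.Iio k) ∧ SameComp E i (c 0)).gcd id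

open Classical in
/-- Cyclicity of a digraph in which every edge lies on a cycle: the l.c.m. of the cyclicities of
the strongly connected components (`1` if there is no edge). -/
noncomputable def cyclicity (E : Fin n → Fin n → Prop) : ℕ :=
  (Finset.univ.filter fun i => ∃ j, E i j).lcm (compCyclicity E)

open Classical in
/-- `A` restricted to the strongly connected component of the node `m` of its digraph; all the
other entries are replaced by `0`. -/
noncomputable def component (A : Matrix (Fin n) (Fin n) ℝ≥0) (m : Fin n) :
    Matrix (Fin n) (Fin n) ℝ≥0 :=
  fun i j => if SameComp (Edge A) m i ∧ SameComp (Edge A) m j then A i j else 0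

/-- The joint cyclicity (l.c.m.) of the critical digraphs of all components of the digraph of
`A`. -/
noncomputable def jointCyclicity (A : Matrix (Fin n) (Fin n) ℝ≥0) : ℕ :=
  Finset.univ.lcm fun m => cyclicity (CritEdge (component A m))

/-- `A` is orbit periodic: every orbit `A^t ⊗ y` is ultimately linear periodic. -/
def OrbitPeriodic (A : Matrix (Fin n) (Fin n) ℝ≥0) : Prop :=
  ∀ y : Fin n → ℝ≥0, ∃ rate : ℝ≥0, ∃ T : ℕ, ∀ t ≥ T,
    mulVec (pow A (t + jointCyclicity A)) y = rate ^ jointCyclicity A • mulVec (pow A t) y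

end Algebra

/-! ### A random access machine over the nonnegative reals

A program is a fixed finite text, the same for all inputs. It works on index registers (natural
numbers) and on two unbounded families of two-dimensional arrays, one with natural numbers and
one with nonnegative reals as entries. Natural numbers can only be copied, compared and changed
by one, so that those that occur in a run exceed the order of the matrix by at most the number of
steps. Nonnegative reals can only be copied, compared, multiplied and maximized; there are no
real constants but `0` and `1`, no roots, no rounding and no conversion between the two sorts. -/

/-- Contents of the memory. -/
structure Store where
  /-- index registers -/
  reg : ℕ → ℕ
  /-- arrays of natural numbers: name of the array, row, column -/
  nat : ℕ → ℕ → ℕ → ℕ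
  /-- arrays of nonnegative reals: name of the array, row, column -/
  real : ℕ → ℕ → ℕ → ℝ≥0

/-- The reference `⟨a, x, y⟩` is to the entry of the array `a` whose row and column are the
contents of the index registers `x` and `y`. -/
structure Ref where
  arr : ℕ
  row : ℕ
  col : ℕ

namespace Store

def getNat (s : Store) (p : Ref) : ℕ := s.nat p.arr (s.reg p.row) (s.reg p.col)

def getReal (s : Store) (p : Ref) : ℝ≥0 := s.real p.arr (s.reg p.row) (s.reg p.col)

def setReg (s : Store) (x v : ℕ) : Store :=
  { s with reg := fun z => if z = x then v else s.reg z }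

def setNat (s : Store) (p : Ref) (v : ℕ) : Store :=
  { s with nat := fun a i j =>
      if a = p.arr ∧ i = s.reg p.row ∧ j = s.reg p.col then v else s.nat a i j }

noncomputable def setReal (s : Store) (p : Ref) (v : ℝ≥0) : Store :=
  { s with real := fun a i j =>
      if a = p.arr ∧ i = s.reg p.row ∧ j = s.reg p.col then v else s.real a i j }

end Store

/-- Elementary operations. -/
inductive Instr where
  | zero (x : ℕ)
  | succ (x : ℕ)
  | pred (x : ℕ)
  | copy (x y : ℕ)
  | load (x : ℕ) (p : Ref)
  | store (p : Ref) (x : ℕ)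
  | realZero (p : Ref)
  | realOne (p : Ref)
  | realCopy (p q : Ref)
  | realMul (p q r : Ref)
  | realMax (p q r : Ref)

/-- Effect of an elementary operation; the first argument is the destination. -/
noncomputable def Instr.apply : Instr → Store → Store
  | zero x, s => s.setReg x 0
  | succ x, s => s.setReg x (s.reg x + 1)
  | pred x, s => s.setReg x (s.reg x - 1)
  | copy x y, s => s.setReg x (s.reg y)
  | load x p, s => s.setReg x (s.getNat p)
  | store p x, s => s.setNat p (s.reg x)
  | realZero p, s => s.setReal p 0
  | realOne p, s => s.setReal p 1
  | realCopy p q, s => s.setReal p (s.getReal q)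
  | realMul p q r, s => s.setReal p (s.getReal q * s.getReal r)
  | realMax p q r, s => s.setReal p (max (s.getReal q) (s.getReal r))

/-- Elementary tests. -/
inductive Test where
  | eq (x y : ℕ)
  | lt (x y : ℕ)
  | realLe (p q : Ref)

def Test.Holds : Test → Store → Prop
  | eq x y, s => s.reg x = s.reg y
  | lt x y, s => s.reg x < s.reg y
  | realLe p q, s => s.getReal p ≤ s.getReal q

/-- Programs. -/
inductive Prog where
  | op (c : Instr)
  | seq (P Q : Prog)
  | ite (b : Test) (P Q : Prog)
  | while (b : Test) (P : Prog)

/-- `Exec P s t s'`: the program `P`, started in the store `s`, stops in the store `s'` after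
exactly `t` operations. Each execution of an elementary operation and each evaluation of an
elementary test counts as one operation. -/
inductive Exec : Prog → Store → ℕ → Store → Prop
  | op (c : Instr) (s : Store) : Exec (.op c) s 1 (c.apply s)
  | seq {P Q : Prog} {s₀ s₁ s₂ : Store} {t u : ℕ} :
      Exec P s₀ t s₁ → Exec Q s₁ u s₂ → Exec (.seq P Q) s₀ (t + u) s₂
  | iteTrue {b : Test} {P Q : Prog} {s₀ s₁ : Store} {t : ℕ} :
      b.Holds s₀ → Exec P s₀ t s₁ → Exec (.ite b P Q) s₀ (1 + t) s₁
  | iteFalse {b : Test} {P Q : Prog} {s₀ s₁ : Store} {t : ℕ} :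
      ¬ b.Holds s₀ → Exec Q s₀ t s₁ → Exec (.ite b P Q) s₀ (1 + t) s₁
  | whileTrue {b : Test} {P : Prog} {s₀ s₁ s₂ : Store} {t u : ℕ} :
      b.Holds s₀ → Exec P s₀ t s₁ → Exec (.while b P) s₁ u s₂ →
      Exec (.while b P) s₀ (1 + t + u) s₂
  | whileFalse {b : Test} {P : Prog} {s : Store} :
      ¬ b.Holds s → Exec (.while b P) s 1 s

/-- The initial store for the input `A`: the index register `0` holds the order `n`, the real
array `0` holds the entries of `A` in its rows and columns `0, …, n - 1`, and everything else is
`0`. -/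
noncomputable def inputStore {n : ℕ} (A : Matrix (Fin n) (Fin n) ℝ≥0) : Store where
  reg x := if x = 0 then n else 0
  nat _ _ _ := 0
  real a i j := if h : a = 0 ∧ i < n ∧ j < n then A ⟨i, h.2.1⟩ ⟨j, h.2.2⟩ else 0

/-- A final store gives the answer "yes" if the index register `0` holds `1`, and "no" if it
holds `0`. -/
def Store.Answers (s : Store) (claim : Prop) : Prop :=
  (claim ∧ s.reg 0 = 1) ∨ (¬ claim ∧ s.reg 0 = 0)

end MaxAlg

/-!
Along a residue class modulo the joint cyclicity the entry `i, j` of `A ^ t` is ultimately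
`W * ρ ^ t`, where `ρ` is the largest maximum cycle geometric mean of a component that meets a walk
from `i` to `j` with a length in that class. Hence `A` is orbit periodic if and only if, for any two
columns, the maximum of their growth rates takes only one nonzero value over all rows and residue
classes. Rows of nodes on cycles and `n` consecutive lengths from `2 * n ^ 2` on are enough to see
all these values. As the machine has no roots, a mean `λ` is replaced by `λ ^ n!`, the largest of
the powers with exponent `n! / k` of the diagonal entries of `A ^ k`. The rates for walks of a
given length are composed like matrices, so `3 * n` squarings at a cost of order `n ^ 3` reach the
length `8 ^ n`.
-/

namespace MaxAlg

/-! ### Walks and matrix powers -/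

section Walks

variable {n : ℕ} {A : Matrix (Fin n) (Fin n) ℝ≥0}

protected theorem mul_assoc (A B C : Matrix (Fin n) (Fin n) ℝ≥0) :
    mul (mul A B) C = mul A (mul B C) := by
  funext i j
  simp only [mul, NNReal.finset_sup_mul, NNReal.mul_finset_sup]
  rw [Finset.sup_comm]
  simp only [mul_assoc]

theorem le_mul_apply (A B : Matrix (Fin n) (Fin n) ℝ≥0) (i u j : Fin n) :
    A i u * B u j ≤ mul A B i j :=
  Finset.le_sup (f := fun k => A i k * B k j) (Finset.mem_univ u)

theorem exists_mul_apply_eq (A B : Matrix (Fin n) (Fin n) ℝ≥0) (i j : Fin n) :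
    ∃ u, mul A B i j = A i u * B u j := by
  obtain ⟨u, -, hu⟩ := Finset.exists_mem_eq_sup Finset.univ ⟨i, Finset.mem_univ i⟩
    (fun k => A i k * B k j)
  exact ⟨u, hu⟩

protected theorem one_mul (A : Matrix (Fin n) (Fin n) ℝ≥0) : mul 1 A = A := by
  funext i j
  refine le_antisymm (Finset.sup_le fun k _ => ?_) (by simpa using le_mul_apply 1 A i i j)
  rcases eq_or_ne i k with rfl | h
  · simp
  · simp [Matrix.one_apply_ne h]

protected theorem mul_one (A : Matrix (Fin n) (Fin n) ℝ≥0) : mul A 1 = A := by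
  funext i j
  refine le_antisymm (Finset.sup_le fun k _ => ?_) (by simpa using le_mul_apply A 1 i j j)
  rcases eq_or_ne k j with rfl | h
  · simp
  · simp [Matrix.one_apply_ne h]

protected theorem pow_one (A : Matrix (Fin n) (Fin n) ℝ≥0) : pow A 1 = A := MaxAlg.one_mul A

protected theorem pow_add (A : Matrix (Fin n) (Fin n) ℝ≥0) (s t : ℕ) :
    pow A (s + t) = mul (pow A s) (pow A t) := by
  induction t with
  | zero => exact (MaxAlg.mul_one _).symm
  | succ t ih => rw [← add_assoc, pow, ih, MaxAlg.mul_assoc, ← pow]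

theorem eq_of_pow_zero_ne_zero {i j : Fin n} (h : pow A 0 i j ≠ 0) : i = j := by
  contrapose! h
  exact Matrix.one_apply_ne h

theorem le_pow_add (A : Matrix (Fin n) (Fin n) ℝ≥0) (s t : ℕ) (i u j : Fin n) :
    pow A s i u * pow A t u j ≤ pow A (s + t) i j := by
  rw [MaxAlg.pow_add]
  exact le_mul_apply _ _ _ _ _

theorem exists_pow_add_eq (A : Matrix (Fin n) (Fin n) ℝ≥0) (s t : ℕ) (i j : Fin n) :
    ∃ u, pow A (s + t) i j = pow A s i u * pow A t u j := by
  rw [MaxAlg.pow_add]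
  exact exists_mul_apply_eq _ _ _ _

theorem pow_add_ne_zero {s t : ℕ} {i u j : Fin n} (h₁ : pow A s i u ≠ 0) (h₂ : pow A t u j ≠ 0) :
    pow A (s + t) i j ≠ 0 :=
  ((mul_pos h₁.bot_lt h₂.bot_lt).trans_le (le_pow_add A s t i u j)).ne'

theorem pow_mul_ne_zero {s : ℕ} {i : Fin n} (h : pow A s i i ≠ 0) (m : ℕ) :
    pow A (m * s) i i ≠ 0 := by
  induction m with
  | zero => simp [pow]
  | succ m ih => rw [Nat.succ_mul]; exact pow_add_ne_zero ih h

theorem weight_add (A : Matrix (Fin n) (Fin n) ℝ≥0) (s t : ℕ) (c : ℕ → Fin n) :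
    weight A (s + t) c = weight A s c * weight A t fun m => c (s + m) := by
  simp only [weight, Finset.prod_range_add, add_assoc]

theorem weight_le_pow (A : Matrix (Fin n) (Fin n) ℝ≥0) (t : ℕ) (c : ℕ → Fin n) :
    weight A t c ≤ pow A t (c 0) (c t) := by
  induction t with
  | zero => simp [weight, pow]
  | succ t ih =>
    rw [weight, Finset.prod_range_succ, pow]
    exact (mul_le_mul_left ih _).trans (le_mul_apply _ _ _ _ _)

theorem exists_weight_eq_pow {t : ℕ} {i j : Fin n} (h : pow A t i j ≠ 0) :
    ∃ c : ℕ → Fin n, c 0 = i ∧ c t = j ∧ weight A t c = pow A t i j := by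
  induction t generalizing j with
  | zero =>
    obtain rfl := eq_of_pow_zero_ne_zero h
    exact ⟨fun _ => i, rfl, rfl, by simp [weight, pow]⟩
  | succ t ih =>
    obtain ⟨u, hu⟩ := exists_mul_apply_eq (pow A t) A i j
    rw [pow, hu] at h ⊢
    obtain ⟨c, rfl, rfl, hc⟩ := ih (left_ne_zero_of_mul h)
    refine ⟨fun m => if m ≤ t then c m else j, by simp, by simp, ?_⟩
    rw [weight, Finset.prod_range_succ, ← hc, weight]
    congr 1
    · refine Finset.prod_congr rfl fun m hm => ?_
      have := Finset.mem_range.1 hm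
      rw [if_pos this.le, if_pos (by omega)]
    · simp

theorem pow_eq_mul_of_weight_eq {s t : ℕ} {c : ℕ → Fin n}
    (hc : weight A (s + t) c = pow A (s + t) (c 0) (c (s + t))) :
    pow A (s + t) (c 0) (c (s + t)) =
      pow A s (c 0) (c s) * pow A t (c s) (c (s + t)) := by
  refine le_antisymm ?_ (le_pow_add _ _ _ _ _ _)
  rw [← hc, weight_add]
  exact mul_le_mul' (weight_le_pow _ _ _) (weight_le_pow A t fun m => c (s + m))

theorem pow_eq_mul_mul_of_weight_eq {s t r : ℕ} {c : ℕ → Fin n}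
    (hc : weight A (s + t + r) c = pow A (s + t + r) (c 0) (c (s + t + r))) :
    pow A (s + t + r) (c 0) (c (s + t + r)) =
      pow A s (c 0) (c s) * pow A t (c s) (c (s + t)) *
        pow A r (c (s + t)) (c (s + t + r)) := by
  refine le_antisymm ?_ ((mul_le_mul_left (le_pow_add _ _ _ _ _ _) _).trans
    (le_pow_add _ _ _ _ _ _))
  rw [← hc, weight_add, weight_add]
  exact mul_le_mul' (mul_le_mul' (weight_le_pow _ _ _) (weight_le_pow A t fun m => c (s + m)))
    (weight_le_pow A r fun m => c (s + t + m))

/-- The pigeonhole principle is applied to the node and the residue modulo `g` of the position on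
a walk of maximal weight. -/
theorem exists_closed_subwalk {g t : ℕ} (hg : 0 < g) (ht : n * g ≤ t) {i j : Fin n}
    (h : pow A t i j ≠ 0) :
    ∃ (u : Fin n) (a b d : ℕ), a + b + d = t ∧ 0 < b ∧ g ∣ b ∧ b ≤ n * g ∧
      pow A t i j = pow A a i u * pow A b u u * pow A d u j := by
  obtain ⟨c, rfl, rfl, hc⟩ := exists_weight_eq_pow h
  obtain ⟨x, hx, y, hy, hxy, he⟩ := Finset.exists_ne_map_eq_of_card_lt_of_maps_to
    (s := Finset.range (n * g + 1)) (t := (Finset.univ : Finset (Fin n)) ×ˢ Finset.range g)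
    (f := fun m => (c m, m % g)) (by simp)
    (fun m _ => by simpa using Nat.mod_lt m hg)
  wlog hlt : x < y generalizing x y
  · exact this y hy x hx hxy.symm he.symm (by omega)
  obtain ⟨hnode, hmod⟩ := Prod.mk.inj he
  rw [Finset.mem_range] at hx hy
  obtain ⟨b, rfl⟩ := Nat.exists_eq_add_of_le hlt.le
  obtain ⟨d, rfl⟩ := Nat.exists_eq_add_of_le (show x + b ≤ t by omega)
  have hdvd : g ∣ b := Nat.modEq_zero_iff_dvd.1
    (Nat.ModEq.add_left_cancel' x (show x + 0 ≡ x + b [MOD g] from hmod)).symm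
  refine ⟨c x, x, b, d, rfl, by omega, hdvd, by omega, ?_⟩
  have hsplit := pow_eq_mul_mul_of_weight_eq hc
  rwa [← hnode] at hsplit

theorem reflTransGen_edge_iff {i j : Fin n} :
    Relation.ReflTransGen (Edge A) i j ↔ ∃ t, pow A t i j ≠ 0 := by
  constructor
  · intro h
    induction h with
    | refl => exact ⟨0, by simp [pow]⟩
    | tail _ hedge ih =>
      obtain ⟨t, ht⟩ := ih
      exact ⟨t + 1, pow_add_ne_zero ht (by rwa [MaxAlg.pow_one])⟩
  · rintro ⟨t, ht⟩
    induction t generalizing j with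
    | zero => exact eq_of_pow_zero_ne_zero ht ▸ .refl
    | succ t ih =>
      obtain ⟨u, hu⟩ := exists_mul_apply_eq (pow A t) A i j
      rw [pow, hu] at ht
      exact (ih (left_ne_zero_of_mul ht)).tail (right_ne_zero_of_mul ht)

theorem sameComp_edge_iff {i j : Fin n} :
    SameComp (Edge A) i j ↔ (∃ s, pow A s i j ≠ 0) ∧ ∃ t, pow A t j i ≠ 0 := by
  rw [SameComp, reflTransGen_edge_iff, reflTransGen_edge_iff]

theorem SameComp.refl (E : Fin n → Fin n → Prop) (i : Fin n) : SameComp E i i := ⟨.refl, .refl⟩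

theorem SameComp.symm {E : Fin n → Fin n → Prop} {i j : Fin n} (h : SameComp E i j) :
    SameComp E j i := ⟨h.2, h.1⟩

theorem SameComp.trans {E : Fin n → Fin n → Prop} {i j k : Fin n} (h : SameComp E i j)
    (h' : SameComp E j k) : SameComp E i k := ⟨h.1.trans h'.1, h'.2.trans h.2⟩

theorem component_congr {u v : Fin n} (h : SameComp (Edge A) u v) :
    component A u = component A v := by
  have hiff : ∀ k, SameComp (Edge A) u k ↔ SameComp (Edge A) v k := fun k =>
    ⟨h.symm.trans, h.trans⟩
  funext i j
  classical exact if_congr (and_congr (hiff i) (hiff j)) rfl rfl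

theorem isCycle_edge_iff {k : ℕ} {c : ℕ → Fin n} :
    IsCycle (Edge A) k c ↔ 0 < k ∧ c k = c 0 ∧ weight A k c ≠ 0 := by
  simp only [IsCycle, weight, Finset.prod_ne_zero_iff, Finset.mem_range, Edge]

theorem IsCycle.sameComp {E : Fin n → Fin n → Prop} {k : ℕ} {c : ℕ → Fin n} (h : IsCycle E k c)
    {t : ℕ} (ht : t ≤ k) : SameComp E (c 0) (c t) := by
  have hpath : ∀ a b, a ≤ b → b ≤ k → Relation.ReflTransGen E (c a) (c b) := fun a b hab hbk =>
    Relation.ReflTransGen.lift c le_rfl _ _ <|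
      reflTransGen_of_succ_of_le (Function.onFun E c)
        (fun x hx => h.2.2 x ((Set.mem_Ico.1 hx).2.trans_le hbk)) hab
  exact ⟨hpath 0 t zero_le ht, h.2.1 ▸ hpath t k ht le_rfl⟩

theorem IsCycle.component_apply {m : Fin n} {k : ℕ} {c : ℕ → Fin n} (h : IsCycle (Edge A) k c)
    (hm : SameComp (Edge A) m (c 0)) {t : ℕ} (ht : t < k) :
    component A m (c t) (c (t + 1)) = A (c t) (c (t + 1)) :=
  if_pos ⟨hm.trans (h.sameComp ht.le), hm.trans (h.sameComp ht)⟩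

theorem IsCycle.weight_component {m : Fin n} {k : ℕ} {c : ℕ → Fin n} (h : IsCycle (Edge A) k c)
    (hm : SameComp (Edge A) m (c 0)) : weight (component A m) k c = weight A k c :=
  Finset.prod_congr rfl fun _ ht => h.component_apply hm (Finset.mem_range.1 ht)

theorem edge_component_iff {m i j : Fin n} :
    Edge (component A m) i j ↔
      (SameComp (Edge A) m i ∧ SameComp (Edge A) m j) ∧ Edge A i j := by
  simp only [Edge, component, ne_eq, ite_eq_right_iff, Classical.not_imp]

theorem isCycle_component_iff {m : Fin n} {k : ℕ} {c : ℕ → Fin n} :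
    IsCycle (Edge (component A m)) k c ↔
      IsCycle (Edge A) k c ∧ SameComp (Edge A) m (c 0) := by
  constructor
  · rintro ⟨hk, hc, h⟩
    simp only [edge_component_iff] at h
    exact ⟨⟨hk, hc, fun t ht => (h t ht).2⟩, (h 0 hk).1.1⟩
  · rintro ⟨h, hm⟩
    refine ⟨h.1, h.2.1, fun t ht => ?_⟩
    rw [Edge, h.component_apply hm ht]
    exact h.2.2 t ht

end Walks

/-! ### Maximum cycle geometric means of the components -/

section Components

variable {n : ℕ} {A : Matrix (Fin n) (Fin n) ℝ≥0}

/-- The maximum cycle geometric mean of the component of the node `v`. -/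
noncomputable def componentMean (A : Matrix (Fin n) (Fin n) ℝ≥0) (v : Fin n) : ℝ≥0 :=
  mcgm (component A v)

/-- The node `v` lies on a critical cycle of its component. -/
def IsCritical (A : Matrix (Fin n) (Fin n) ℝ≥0) (v : Fin n) : Prop :=
  ∃ j, CritEdge (component A v) v j

/-- The largest geometric mean of the closed walks with `p.2` edges at the node `p.1`. -/
noncomputable def closedWalkMean (A : Matrix (Fin n) (Fin n) ℝ≥0) (p : Fin n × ℕ) : ℝ≥0 :=
  pow A p.2 p.1 p.1 ^ (1 / (p.2 : ℝ))

open Classical in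
/-- The nodes of the component of `v`, paired with the possible lengths of short closed walks. -/
noncomputable def shortClosedWalks (A : Matrix (Fin n) (Fin n) ℝ≥0) (v : Fin n) :
    Finset (Fin n × ℕ) :=
  Finset.univ.filter (SameComp (Edge A) v) ×ˢ Finset.Icc 1 n

theorem mem_shortClosedWalks {u v : Fin n} {k : ℕ} :
    (u, k) ∈ shortClosedWalks A v ↔ SameComp (Edge A) v u ∧ 1 ≤ k ∧ k ≤ n := by
  simp [shortClosedWalks]

theorem componentMean_congr {u v : Fin n} (h : SameComp (Edge A) u v) :
    componentMean A u = componentMean A v := by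
  rw [componentMean, componentMean, component_congr h]

theorem closedWalkMean_le_iff {v : Fin n} {k : ℕ} (hk : 0 < k) {x : ℝ≥0} :
    closedWalkMean A (v, k) ≤ x ↔ pow A k v v ≤ x ^ k := by
  rw [closedWalkMean, one_div, NNReal.rpow_inv_le_iff (by positivity), NNReal.rpow_natCast]

theorem closedWalkMean_lt_iff {v : Fin n} {k : ℕ} (hk : 0 < k) {x : ℝ≥0} :
    closedWalkMean A (v, k) < x ↔ pow A k v v < x ^ k := by
  rw [closedWalkMean, one_div, NNReal.rpow_inv_lt_iff (by positivity), NNReal.rpow_natCast]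

theorem closedWalkMean_eq_iff {v : Fin n} {k : ℕ} (hk : 0 < k) {x : ℝ≥0} :
    closedWalkMean A (v, k) = x ↔ pow A k v v = x ^ k := by
  rw [closedWalkMean, one_div, NNReal.rpow_inv_eq_iff (by positivity), NNReal.rpow_natCast]

theorem geomMean_eq_iff {k : ℕ} (hk : 0 < k) {c : ℕ → Fin n} {x : ℝ≥0} :
    geomMean A k c = x ↔ weight A k c = x ^ k := by
  rw [geomMean, ← NNReal.rpow_natCast, one_div, NNReal.rpow_inv_eq_iff (by positivity)]

theorem IsCycle.geomMean_component_le {v : Fin n} {k : ℕ} {c : ℕ → Fin n}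
    (hc : IsCycle (Edge (component A v)) k c) :
    geomMean (component A v) k c ≤ closedWalkMean A (c 0, k) := by
  obtain ⟨hcA, hv⟩ := isCycle_component_iff.1 hc
  rw [geomMean, hcA.weight_component hv]
  exact NNReal.rpow_le_rpow (by simpa [hcA.2.1] using weight_le_pow A k c) (by positivity)

theorem exists_geomMean_component_eq {u v : Fin n} (hu : SameComp (Edge A) v u) {k : ℕ}
    (hk : 0 < k) (h0 : pow A k u u ≠ 0) :
    ∃ c, IsCycle (Edge (component A v)) k c ∧
      geomMean (component A v) k c = closedWalkMean A (u, k) := by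
  obtain ⟨c, rfl, hck, hw⟩ := exists_weight_eq_pow h0
  have hcyc : IsCycle (Edge A) k c := isCycle_edge_iff.2 ⟨hk, hck, hw ▸ h0⟩
  refine ⟨c, isCycle_component_iff.2 ⟨hcyc, hu⟩, ?_⟩
  rw [geomMean, hcyc.weight_component hu, hw, closedWalkMean]

theorem componentMean_eq_sup (A : Matrix (Fin n) (Fin n) ℝ≥0) (v : Fin n) :
    componentMean A v = (shortClosedWalks A v).sup (closedWalkMean A) := by
  have hub : (shortClosedWalks A v).sup (closedWalkMean A) ∈ upperBounds
      {x | ∃ k c, k ≤ n ∧ IsCycle (Edge (component A v)) k c ∧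
        x = geomMean (component A v) k c} := by
    rintro x ⟨k, c, hk, hc, rfl⟩
    exact hc.geomMean_component_le.trans <| Finset.le_sup <|
      mem_shortClosedWalks.2 ⟨(isCycle_component_iff.1 hc).2, hc.1, hk⟩
  refine le_antisymm (csSup_le' hub) (Finset.sup_le ?_)
  rintro ⟨u, k⟩ hp
  obtain ⟨hu, hk, hkn⟩ := mem_shortClosedWalks.1 hp
  by_cases h0 : pow A k u u = 0
  · exact (closedWalkMean_le_iff hk).2 (h0 ▸ zero_le)
  · obtain ⟨c, hc, hmean⟩ := exists_geomMean_component_eq hu hk h0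
    exact hmean ▸ le_csSup ⟨_, hub⟩ ⟨k, c, hkn, hc, rfl⟩

theorem pow_self_le_of_le {b : ℕ} (hb : 0 < b) (hbn : b ≤ n) (u : Fin n) :
    pow A b u u ≤ componentMean A u ^ b := by
  rw [← closedWalkMean_le_iff hb, componentMean_eq_sup]
  exact Finset.le_sup (mem_shortClosedWalks.2 ⟨.refl _ u, hb, hbn⟩)

theorem pow_self_le (A : Matrix (Fin n) (Fin n) ℝ≥0) (k : ℕ) (v : Fin n) :
    pow A k v v ≤ componentMean A v ^ k := by
  induction k using Nat.strong_induction_on with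
  | _ k ih =>
  rcases Nat.eq_zero_or_pos k with rfl | hk
  · simp [pow]
  rcases le_or_gt k n with hkn | hkn
  · exact pow_self_le_of_le hk hkn v
  by_cases h0 : pow A k v v = 0
  · simp [h0]
  obtain ⟨u, a, b, d, rfl, hb, -, hbn, hsplit⟩ :=
    exists_closed_subwalk (g := 1) one_pos (by omega) h0
  rw [hsplit] at h0
  have huv : SameComp (Edge A) u v := sameComp_edge_iff.2
    ⟨⟨d, right_ne_zero_of_mul h0⟩, a, left_ne_zero_of_mul (left_ne_zero_of_mul h0)⟩
  rw [hsplit, mul_right_comm, show a + b + d = (a + d) + b by omega, pow_add]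
  refine mul_le_mul' ((le_pow_add _ _ _ _ _ _).trans (ih (a + d) (by omega))) ?_
  rw [← componentMean_congr huv]
  exact pow_self_le_of_le hb (by simpa using hbn) u

theorem componentMean_ne_zero {k : ℕ} {v : Fin n} (hk : 0 < k) (h : pow A k v v ≠ 0) :
    componentMean A v ≠ 0 := by
  intro h0
  have hle := pow_self_le A k v
  rw [h0, zero_pow hk.ne'] at hle
  exact h (le_zero_iff.1 hle)

theorem isCritical_of_pow_eq {b : ℕ} {v : Fin n} (hb : 0 < b) (h0 : componentMean A v ≠ 0)
    (h : pow A b v v = componentMean A v ^ b) : IsCritical A v := by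
  obtain ⟨c, hc0, hcb, hw⟩ := exists_weight_eq_pow (h ▸ pow_ne_zero b h0)
  have hcyc : IsCycle (Edge A) b c :=
    isCycle_edge_iff.2 ⟨hb, hcb.trans hc0.symm, by rw [hw, h]; exact pow_ne_zero b h0⟩
  have hv : SameComp (Edge A) v (c 0) := hc0.symm ▸ .refl _ v
  refine ⟨c 1, b, c, isCycle_component_iff.2 ⟨hcyc, hv⟩, ?_, 0, hb, hc0, rfl⟩
  rw [geomMean_eq_iff hb, hcyc.weight_component hv, hw, h, componentMean]

theorem exists_pow_eq_componentMean_pow (A : Matrix (Fin n) (Fin n) ℝ≥0) (v : Fin n) :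
    ∃ u k, SameComp (Edge A) v u ∧ 0 < k ∧ k ≤ n ∧ pow A k u u = componentMean A v ^ k := by
  obtain ⟨⟨u, k⟩, hp, hmax⟩ := Finset.exists_mem_eq_sup (shortClosedWalks A v)
    ⟨(v, 1), mem_shortClosedWalks.2 ⟨.refl _ v, le_rfl, v.pos⟩⟩ (closedWalkMean A)
  obtain ⟨hu, hk, hkn⟩ := mem_shortClosedWalks.1 hp
  exact ⟨u, k, hu, hk, hkn,
    (closedWalkMean_eq_iff hk).1 (hmax.symm.trans (componentMean_eq_sup A v).symm)⟩

theorem exists_isCritical {v : Fin n} (h : componentMean A v ≠ 0) :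
    ∃ u k, SameComp (Edge A) v u ∧ IsCritical A u ∧ 0 < k ∧ k ≤ n ∧
      pow A k u u = componentMean A v ^ k := by
  obtain ⟨u, k, hu, hk, hkn, hpow⟩ := exists_pow_eq_componentMean_pow A v
  refine ⟨u, k, hu, ?_, hk, hkn, hpow⟩
  rw [componentMean_congr hu] at h hpow
  exact isCritical_of_pow_eq hk h hpow

end Components

/-! ### Walks in the critical digraph -/

section Critical

variable {n : ℕ} {A : Matrix (Fin n) (Fin n) ℝ≥0}

open Classical in
/-- The critical edges in the component of the node `v` with their weights. -/
noncomputable def critMatrix (A : Matrix (Fin n) (Fin n) ℝ≥0) (v : Fin n) :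
    Matrix (Fin n) (Fin n) ℝ≥0 :=
  fun i j => if CritEdge (component A v) i j then A i j else 0

theorem CritEdge.apply_ne_zero {v i j : Fin n} (h : CritEdge (component A v) i j) : A i j ≠ 0 := by
  obtain ⟨k, c, hc, -, t, ht, rfl, rfl⟩ := h
  exact (isCycle_component_iff.1 hc).1.2.2 t ht

theorem CritEdge.componentMean_ne_zero {v i j : Fin n} (h : CritEdge (component A v) i j) :
    componentMean A v ≠ 0 := by
  obtain ⟨k, c, hc, hmean, -⟩ := h
  have hw := (isCycle_edge_iff.1 hc).2.2
  rw [(geomMean_eq_iff hc.1).1 hmean] at hw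
  exact ne_zero_pow hc.1.ne' hw

theorem CritEdge.exists_return {v i j : Fin n} (h : CritEdge (component A v) i j) :
    ∃ r, componentMean A v ^ (r + 1) ≤ pow A r j i * A i j := by
  obtain ⟨k, c, hc, hmean, t, ht, rfl, rfl⟩ := h
  obtain ⟨hc, hv⟩ := isCycle_component_iff.1 hc
  rw [geomMean_eq_iff hc.1, hc.weight_component hv] at hmean
  obtain ⟨d, rfl⟩ := Nat.exists_eq_add_of_lt ht
  have hclosed : c (t + 1 + d) = c 0 := by rw [add_right_comm]; exact hc.2.1
  refine ⟨d + t, ?_⟩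
  calc componentMean A v ^ (d + t + 1)
      = weight A t c * A (c t) (c (t + 1)) * weight A d (fun m => c (t + 1 + m)) := by
        rw [show d + t + 1 = t + d + 1 by omega, componentMean, ← hmean, add_right_comm, weight_add,
          weight, Finset.prod_range_succ, ← weight]
    _ = weight A d (fun m => c (t + 1 + m)) * weight A t c * A (c t) (c (t + 1)) := by ring
    _ ≤ pow A d (c (t + 1)) (c 0) * pow A t (c 0) (c t) * A (c t) (c (t + 1)) := by
        gcongr
        · simpa [hclosed] using weight_le_pow A d fun m => c (t + 1 + m)
        · exact weight_le_pow A t c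
    _ ≤ pow A (d + t) (c (t + 1)) (c t) * A (c t) (c (t + 1)) := by
        gcongr
        exact le_pow_add _ _ _ _ _ _

theorem critMatrix_le (A : Matrix (Fin n) (Fin n) ℝ≥0) (v i j : Fin n) :
    critMatrix A v i j ≤ A i j := by
  unfold critMatrix
  split_ifs <;> simp

theorem edge_critMatrix {v : Fin n} : Edge (critMatrix A v) = CritEdge (component A v) := by
  funext i j
  have : CritEdge (component A v) i j → A i j ≠ 0 := CritEdge.apply_ne_zero
  simpa [Edge, critMatrix]

theorem pow_mono {B : Matrix (Fin n) (Fin n) ℝ≥0} (h : ∀ i j, B i j ≤ A i j) (t : ℕ) (i j : Fin n) :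
    pow B t i j ≤ pow A t i j := by
  induction t generalizing j with
  | zero => exact le_rfl
  | succ t ih => exact Finset.sup_mono_fun fun k _ => mul_le_mul' (ih k) (h k j)

theorem exists_return_of_pow_critMatrix_ne_zero {v : Fin n} (t : ℕ) {i j : Fin n}
    (h : pow (critMatrix A v) t i j ≠ 0) :
    ∃ r, componentMean A v ^ (r + t) ≤ pow A r j i * pow (critMatrix A v) t i j := by
  induction t generalizing j with
  | zero =>
    obtain rfl := eq_of_pow_zero_ne_zero h
    exact ⟨0, by simp [pow]⟩
  | succ t ih =>
    obtain ⟨u, hu⟩ := exists_mul_apply_eq (pow (critMatrix A v) t) (critMatrix A v) i j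
    rw [pow, hu] at h ⊢
    have hedge : CritEdge (component A v) u j := edge_critMatrix ▸ right_ne_zero_of_mul h
    have hA : critMatrix A v u j = A u j := if_pos hedge
    obtain ⟨r, hr⟩ := ih (left_ne_zero_of_mul h)
    obtain ⟨q, hq⟩ := hedge.exists_return
    refine ⟨q + r, ?_⟩
    calc componentMean A v ^ (q + r + (t + 1))
        = componentMean A v ^ (q + 1) * componentMean A v ^ (r + t) := by ring
      _ ≤ (pow A q j u * A u j) * (pow A r u i * pow (critMatrix A v) t i u) := mul_le_mul' hq hr
      _ = (pow A q j u * pow A r u i) * (pow (critMatrix A v) t i u * critMatrix A v u j) := by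
          rw [hA]; ring
      _ ≤ pow A (q + r) j i * (pow (critMatrix A v) t i u * critMatrix A v u j) :=
          mul_le_mul_left (le_pow_add _ _ _ _ _ _) _

theorem pow_self_eq_of_pow_critMatrix_ne_zero {v : Fin n} (h0 : componentMean A v ≠ 0) {t : ℕ}
    (h : pow (critMatrix A v) t v v ≠ 0) : pow A t v v = componentMean A v ^ t := by
  obtain ⟨r, hr⟩ := exists_return_of_pow_critMatrix_ne_zero t h
  refine le_antisymm (pow_self_le A t v) (le_trans ?_ (pow_mono (critMatrix_le A v) t v v))
  rw [pow_add] at hr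
  exact le_of_mul_le_mul_left (hr.trans (mul_le_mul_left (pow_self_le A r v) _))
    (pow_pos h0.bot_lt r)

theorem IsCritical.componentMean_ne_zero {v : Fin n} (hv : IsCritical A v) :
    componentMean A v ≠ 0 :=
  hv.choose_spec.componentMean_ne_zero

theorem IsCritical.compCyclicity_dvd {v : Fin n} (hv : IsCritical A v) :
    compCyclicity (CritEdge (component A v)) v ∣ jointCyclicity A := by
  classical
  refine dvd_trans ?_ (Finset.dvd_lcm (Finset.mem_univ v))
  exact Finset.dvd_lcm (f := compCyclicity (CritEdge (component A v)))
    (Finset.mem_filter.2 ⟨Finset.mem_univ v, hv⟩)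

/-- The lengths of the closed walks of `B` at `v`. -/
def closedWalkLengths (B : Matrix (Fin n) (Fin n) ℝ≥0) (v : Fin n) : AddSubmonoid ℕ where
  carrier := {m | pow B m v v ≠ 0}
  zero_mem' := by simp [pow]
  add_mem' := pow_add_ne_zero

theorem setGcd_closedWalkLengths_dvd (B : Matrix (Fin n) (Fin n) ℝ≥0) (v : Fin n) :
    Nat.setGcd (closedWalkLengths B v : Set ℕ) ∣ compCyclicity (Edge B) v := by
  classical
  refine Finset.dvd_gcd fun k hk => ?_
  obtain ⟨-, c, hc, -, hsame⟩ := Finset.mem_filter.1 hk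
  obtain ⟨⟨s, hs⟩, t, ht⟩ := sameComp_edge_iff.1 hsame
  have hk : pow B k (c 0) (c 0) ≠ 0 := by
    simpa [hc.2.1] using ((isCycle_edge_iff.1 hc).2.2.bot_lt.trans_le (weight_le_pow _ _ _)).ne'
  have h1 : Nat.setGcd (closedWalkLengths B v : Set ℕ) ∣ s + t :=
    Nat.setGcd_dvd_of_mem (pow_add_ne_zero hs ht)
  have h2 : Nat.setGcd (closedWalkLengths B v : Set ℕ) ∣ s + k + t :=
    Nat.setGcd_dvd_of_mem (pow_add_ne_zero (pow_add_ne_zero hs hk) ht)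
  rw [add_right_comm] at h2
  exact (Nat.dvd_add_right h1).1 h2

theorem IsCritical.exists_forall_pow_self_eq {v : Fin n} (hv : IsCritical A v) :
    ∃ N, ∀ m ≥ N, jointCyclicity A ∣ m → pow A m v v = componentMean A v ^ m := by
  obtain ⟨N, hN⟩ := Nat.exists_mem_closure_of_ge (closedWalkLengths (critMatrix A v) v : Set ℕ)
  rw [AddSubmonoid.closure_eq] at hN
  refine ⟨N, fun m hm hd => pow_self_eq_of_pow_critMatrix_ne_zero hv.componentMean_ne_zero
    (hN m hm (((setGcd_closedWalkLengths_dvd _ v).trans ?_).trans hd))⟩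
  rw [edge_critMatrix]
  exact hv.compCyclicity_dvd

theorem IsCycle.exists_simple {E : Fin n → Fin n → Prop} {k : ℕ} {c : ℕ → Fin n}
    (h : IsCycle E k c) :
    ∃ l d, IsCycle E l d ∧ Set.InjOn d (Set.Iio l) ∧ ∃ s ≤ k, d 0 = c s := by
  induction k using Nat.strong_induction_on generalizing c with
  | _ k ih =>
  by_cases hinj : Set.InjOn c (Set.Iio k)
  · exact ⟨k, c, h, hinj, 0, zero_le, rfl⟩
  · simp only [Set.InjOn, Set.mem_Iio] at hinj
    push Not at hinj
    obtain ⟨x, hx, y, hy, hxy, hne⟩ := hinj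
    wlog hlt : x < y generalizing x y
    · exact this y hy x hx hxy.symm hne.symm (by omega)
    obtain ⟨l, d, hd, hi, s, hsl, hs⟩ := ih (y - x) (by omega) (c := fun m => c (x + m))
      ⟨by omega, by simp [Nat.add_sub_cancel' hlt.le, hxy], fun t ht => h.2.2 (x + t) (by omega)⟩
    exact ⟨l, d, hd, hi, x + s, by omega, hs⟩

theorem IsCycle.compCyclicity_ne_zero {E : Fin n → Fin n → Prop} {k : ℕ} {c : ℕ → Fin n}
    (h : IsCycle E k c) {t : ℕ} (ht : t ≤ k) : compCyclicity E (c t) ≠ 0 := by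
  classical
  obtain ⟨l, d, hd, hinj, s, hsk, hs⟩ := h.exists_simple
  have hln : l ≤ n := by
    simpa using Finset.card_le_card_of_injOn (s := Finset.range l) (t := Finset.univ) d (by simp)
      (by simpa using hinj)
  have hsame : SameComp E (c t) (d 0) := hs ▸ (h.sameComp ht).symm.trans (h.sameComp hsk)
  intro h0
  rw [compCyclicity, Finset.gcd_eq_zero_iff] at h0
  exact hd.1.ne' (h0 l (Finset.mem_filter.2 ⟨Finset.mem_Icc.2 ⟨hd.1, hln⟩, d, hd, hinj, hsame⟩))

theorem jointCyclicity_pos (A : Matrix (Fin n) (Fin n) ℝ≥0) : 0 < jointCyclicity A := by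
  classical
  refine Nat.pos_of_ne_zero fun h0 => ?_
  obtain ⟨m, -, hm⟩ := Finset.lcm_eq_zero_iff.1 h0
  obtain ⟨i, hi, hzero⟩ := Finset.lcm_eq_zero_iff.1 hm
  obtain ⟨j, k, c, hcyc, hmean, t, ht, rfl, rfl⟩ := (Finset.mem_filter.1 hi).2
  have hcrit : IsCycle (CritEdge (component A m)) k c :=
    ⟨hcyc.1, hcyc.2.1, fun s hs => ⟨k, c, hcyc, hmean, s, hs, rfl, rfl⟩⟩
  exact hcrit.compCyclicity_ne_zero ht.le hzero

end Critical

/-! ### Growth rates of the entries of matrix powers -/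

section Rates

open Filter

variable {n : ℕ} {A : Matrix (Fin n) (Fin n) ℝ≥0}

/-- There is a walk of length `t` from `i` to `j` that visits `v`. -/
def WalkThrough (A : Matrix (Fin n) (Fin n) ℝ≥0) (i v j : Fin n) (t : ℕ) : Prop :=
  ∃ a b, a + b = t ∧ pow A a i v ≠ 0 ∧ pow A b v j ≠ 0

theorem WalkThrough.pow_ne_zero {i v j : Fin n} {t : ℕ} (h : WalkThrough A i v j t) :
    pow A t i j ≠ 0 := by
  obtain ⟨a, b, rfl, ha, hb⟩ := h
  exact pow_add_ne_zero ha hb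

theorem WalkThrough.append {i v j k : Fin n} {s t : ℕ} (h : WalkThrough A i v j s)
    (h' : pow A t j k ≠ 0) : WalkThrough A i v k (s + t) := by
  obtain ⟨a, b, rfl, ha, hb⟩ := h
  exact ⟨a, b + t, by ring, ha, pow_add_ne_zero hb h'⟩

theorem WalkThrough.prepend {i v j k : Fin n} {s t : ℕ} (h' : pow A s k i ≠ 0)
    (h : WalkThrough A i v j t) : WalkThrough A k v j (s + t) := by
  obtain ⟨a, b, rfl, ha, hb⟩ := h
  exact ⟨s + a, b, by ring, pow_add_ne_zero h' ha, hb⟩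

theorem WalkThrough.insert {i v j : Fin n} {s t : ℕ} (h : WalkThrough A i v j s)
    (h' : pow A t v v ≠ 0) : WalkThrough A i v j (s + t) := by
  obtain ⟨a, b, rfl, ha, hb⟩ := h
  exact ⟨a + t, b, by ring, pow_add_ne_zero ha h', hb⟩

/-- A detour to `u` and back, taken `g` times, does not change the length modulo `g`. -/
theorem WalkThrough.exists_modEq {i v u j : Fin n} {t g : ℕ} (h : WalkThrough A i v j t)
    (hu : SameComp (Edge A) v u) (hg : 0 < g) : ∃ t', t' ≡ t [MOD g] ∧ WalkThrough A i u j t' := by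
  obtain ⟨a, b, rfl, ha, hb⟩ := h
  obtain ⟨⟨p, hp⟩, q, hq⟩ := sameComp_edge_iff.1 hu
  obtain ⟨g, rfl⟩ := Nat.exists_eq_succ_of_ne_zero hg.ne'
  exact ⟨a + b + (g + 1) * (p + q), by simp [Nat.ModEq], a + p, q + g * (p + q) + b, by ring,
    pow_add_ne_zero ha hp,
    pow_add_ne_zero (pow_add_ne_zero hq (pow_mul_ne_zero (pow_add_ne_zero hp hq) _)) hb⟩

theorem exists_mem_eq_sup_of_ne_zero {ι : Type*} {s : Finset ι} {f : ι → ℝ≥0}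
    (h : s.sup f ≠ 0) : ∃ x ∈ s, s.sup f = f x :=
  s.exists_mem_eq_sup (Finset.nonempty_iff_ne_empty.2 fun h0 => h (h0 ▸ Finset.sup_empty)) f

open Classical in
/-- The growth rate of the entry `i, j` of `A ^ t` for `t` congruent to `r` modulo the joint
cyclicity. -/
noncomputable def growthRate (A : Matrix (Fin n) (Fin n) ℝ≥0) (i j : Fin n) (r : ℕ) : ℝ≥0 :=
  (Finset.univ.filter fun v => ∃ t, t ≡ r [MOD jointCyclicity A] ∧ WalkThrough A i v j t).sup
    (componentMean A)

theorem WalkThrough.componentMean_le_growthRate {i v j : Fin n} {t r : ℕ}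
    (h : WalkThrough A i v j t) (hr : t ≡ r [MOD jointCyclicity A]) :
    componentMean A v ≤ growthRate A i j r :=
  Finset.le_sup (f := componentMean A) (by simpa using ⟨t, hr, h⟩)

theorem exists_componentMean_eq_growthRate {i j : Fin n} {r : ℕ} (h : growthRate A i j r ≠ 0) :
    ∃ v t, t ≡ r [MOD jointCyclicity A] ∧
      WalkThrough A i v j t ∧ componentMean A v = growthRate A i j r := by
  classical
  obtain ⟨v, hv, hmax⟩ := exists_mem_eq_sup_of_ne_zero h
  obtain ⟨t, ht, htv⟩ := (Finset.mem_filter.1 hv).2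
  exact ⟨v, t, ht, htv, hmax.symm⟩

theorem growthRate_congr {i j : Fin n} {r s : ℕ} (h : r ≡ s [MOD jointCyclicity A]) :
    growthRate A i j r = growthRate A i j s := by
  have hmod : ∀ t, t ≡ r [MOD jointCyclicity A] ↔ t ≡ s [MOD jointCyclicity A] :=
    fun t => ⟨fun ht => ht.trans h, fun ht => ht.trans h.symm⟩
  unfold growthRate
  congr 1
  ext v
  simp only [Finset.mem_filter, hmod]

theorem pow_eq_zero_of_growthRate_eq_zero {t : ℕ} (ht : n ≤ t) {i j : Fin n}
    (h0 : growthRate A i j t = 0) : pow A t i j = 0 := by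
  by_contra h
  obtain ⟨u, a, b, d, rfl, hb, -, -, hsplit⟩ :=
    exists_closed_subwalk (g := 1) one_pos (by omega) h
  rw [hsplit] at h
  have hab := left_ne_zero_of_mul h
  have hwalk : WalkThrough A i u j (a + b + d) := ⟨a, b + d, by ring, left_ne_zero_of_mul hab,
    pow_add_ne_zero (right_ne_zero_of_mul hab) (right_ne_zero_of_mul h)⟩
  have hle := hwalk.componentMean_le_growthRate rfl
  rw [h0] at hle
  exact componentMean_ne_zero hb (right_ne_zero_of_mul hab) (le_zero_iff.1 hle)

/-- Removing closed subwalks does not decrease the weight normalized by the powers of `l`. -/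
theorem exists_short_walk {i j : Fin n} {l : ℝ≥0} {g a : ℕ} (hg : 0 < g)
    (hl : ∀ w t, t ≡ a [MOD g] → WalkThrough A i w j t → componentMean A w ≤ l)
    (h : pow A a i j ≠ 0) :
    ∃ b < n * g, b ≡ a [MOD g] ∧ pow A b i j ≠ 0 ∧ pow A a i j * l ^ b ≤ pow A b i j * l ^ a := by
  induction a using Nat.strong_induction_on with
  | _ a ih =>
  rcases lt_or_ge a (n * g) with ha | ha
  · exact ⟨a, ha, rfl, h, le_rfl⟩
  obtain ⟨u, x, b, y, rfl, hb, hgb, -, hsplit⟩ := exists_closed_subwalk hg ha h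
  have hm : x + y ≡ x + b + y [MOD g] := by
    rw [add_right_comm]
    exact ((Nat.modEq_zero_iff_dvd.2 hgb).add_left (x + y)).symm
  have h' := hsplit ▸ h
  have hx := left_ne_zero_of_mul (left_ne_zero_of_mul h')
  have hy := right_ne_zero_of_mul h'
  obtain ⟨c, hc, hcm, hc0, hle⟩ := ih (x + y) (by omega)
    (fun w t ht => hl w t (ht.trans hm)) (pow_add_ne_zero hx hy)
  refine ⟨c, hc, hcm.trans hm, hc0, ?_⟩
  have hbl : pow A b u u ≤ l ^ b :=
    (pow_self_le A b u).trans (pow_le_pow_left' (hl u (x + y) hm ⟨x, y, rfl, hx, hy⟩) b)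
  calc pow A (x + b + y) i j * l ^ c
      = (pow A x i u * pow A y u j) * l ^ c * pow A b u u := by rw [hsplit]; ring
    _ ≤ pow A (x + y) i j * l ^ c * l ^ b := by
        gcongr
        exact le_pow_add _ _ _ _ _ _
    _ ≤ pow A c i j * l ^ (x + y) * l ^ b := by gcongr
    _ = pow A c i j * l ^ (x + b + y) := by ring

theorem eventually_mul_pow_le {x z : ℝ≥0} (h : x < z) (a : ℝ≥0) {b : ℝ≥0} (hb : 0 < b) :
    ∀ᶠ t : ℕ in atTop, a * x ^ t ≤ b * z ^ t := by
  have hz : 0 < z := bot_lt_of_lt h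
  have hlim : Tendsto (fun t : ℕ => a * (x / z) ^ t) atTop (nhds 0) := by
    simpa using (NNReal.tendsto_pow_atTop_nhds_zero_of_lt_one ((div_lt_one hz).2 h)).const_mul a
  filter_upwards [hlim.eventually_le_const hb] with t ht
  rwa [div_pow, ← mul_div_assoc, div_le_iff₀ (pow_pos hz t)] at ht

theorem exists_pow_le_mul_pow {m : ℝ≥0} (hm : 0 < m)
    (h : ∀ b u, 0 < b → b ≤ n → pow A b u u ≤ m ^ b) : ∃ C, ∀ t i j, pow A t i j ≤ C * m ^ t := by
  let f : ℕ × Fin n × Fin n → ℝ≥0 := fun p => pow A p.1 p.2.1 p.2.2 / m ^ p.1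
  refine ⟨(Finset.range n ×ˢ Finset.univ).sup f, fun t => ?_⟩
  induction t using Nat.strong_induction_on with
  | _ t ih =>
  intro i j
  rcases lt_or_ge t n with ht | ht
  · rw [← div_le_iff₀ (pow_pos hm t)]
    exact Finset.le_sup (f := f) (b := (t, i, j)) (by simpa using ht)
  by_cases h0 : pow A t i j = 0
  · exact h0 ▸ zero_le
  obtain ⟨u, x, b, y, rfl, hb, -, hbn, hsplit⟩ :=
    exists_closed_subwalk (g := 1) one_pos (by omega) h0
  calc pow A (x + b + y) i j = (pow A x i u * pow A y u j) * pow A b u u := by rw [hsplit]; ring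
    _ ≤ (_ * m ^ (x + y)) * m ^ b :=
        mul_le_mul' ((le_pow_add _ _ _ _ _ _).trans (ih (x + y) (by omega) i j))
          (h b u hb (by omega))
    _ = _ * m ^ (x + b + y) := by ring

theorem eventually_pow_le_mul_pow {l : ℝ≥0} (hl : 0 < l)
    (h : ∀ b u, 0 < b → b ≤ n → pow A b u u < l ^ b) {ε : ℝ≥0} (hε : 0 < ε) :
    ∀ᶠ t in atTop, ∀ i j, pow A t i j ≤ ε * l ^ t := by
  have hsup : (Finset.univ ×ˢ Finset.Icc 1 n).sup (closedWalkMean A) < l := by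
    refine (Finset.sup_lt_iff hl).2 ?_
    rintro ⟨u, k⟩ hk
    obtain ⟨hk, hkn⟩ := Finset.mem_Icc.1 (Finset.mem_product.1 hk).2
    exact (closedWalkMean_lt_iff hk).2 (h k u hk hkn)
  obtain ⟨m, hm, hml⟩ := exists_between hsup
  obtain ⟨C, hC⟩ := exists_pow_le_mul_pow (bot_lt_of_lt hm) fun b u hb hbn =>
    (closedWalkMean_le_iff hb).1 <| hm.le.trans' <| Finset.le_sup <| by
      simpa using ⟨hb, hbn⟩
  filter_upwards [eventually_mul_pow_le hml C hε] with t ht i j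
  exact (hC t i j).trans ht

end Rates

/-! ### Asymptotics of the matrix powers -/

section Asymptotics

open Filter

variable {n : ℕ} {A : Matrix (Fin n) (Fin n) ℝ≥0}

/-- The node `u` is critical and its component accounts for the growth rate of the entry `i, j` in
the residue class of `r`. -/
def IsDominant (A : Matrix (Fin n) (Fin n) ℝ≥0) (i j : Fin n) (r : ℕ) (u : Fin n) : Prop :=
  IsCritical A u ∧ componentMean A u = growthRate A i j r

open Classical in
/-- The nodes `p.1` and the lengths `p.2.1`, `p.2.2` of short walks from `i` to `p.1` and from
`p.1` to `j` which determine the coefficient of the entry `i, j` in the residue class of `r`. -/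
noncomputable def dominantWalks (A : Matrix (Fin n) (Fin n) ℝ≥0) (i j : Fin n) (r : ℕ) :
    Finset (Fin n × ℕ × ℕ) :=
  (Finset.univ ×ˢ Finset.range (n * jointCyclicity A) ×ˢ
    Finset.range (n * jointCyclicity A)).filter
      fun p => IsDominant A i j r p.1 ∧ p.2.1 + p.2.2 ≡ r [MOD jointCyclicity A]

theorem mem_dominantWalks {i j u : Fin n} {r a b : ℕ} :
    (u, a, b) ∈ dominantWalks A i j r ↔
      (a < n * jointCyclicity A ∧ b < n * jointCyclicity A) ∧
        IsDominant A i j r u ∧ a + b ≡ r [MOD jointCyclicity A] := by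
  simp [dominantWalks]

/-- The largest weight of a walk from `i` to `j` through a dominant node, normalized by the powers
of the growth rate: the factor `W` in `pow A t i j = W * growthRate A i j t ^ t`, for large `t`
congruent to `r` modulo the joint cyclicity. -/
noncomputable def growthCoeff (A : Matrix (Fin n) (Fin n) ℝ≥0) (i j : Fin n) (r : ℕ) : ℝ≥0 :=
  (dominantWalks A i j r).sup fun p =>
    pow A p.2.1 i p.1 * pow A p.2.2 p.1 j / growthRate A i j r ^ (p.2.1 + p.2.2)

theorem growthCoeff_congr {i j : Fin n} {r s : ℕ} (h : r ≡ s [MOD jointCyclicity A]) :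
    growthCoeff A i j r = growthCoeff A i j s := by
  have hwalks : dominantWalks A i j r = dominantWalks A i j s := by
    ext ⟨u, a, b⟩
    simp only [mem_dominantWalks, IsDominant, growthRate_congr h]
    exact and_congr_right' (and_congr_right' ⟨fun hr => hr.trans h, fun hs => hs.trans h.symm⟩)
  rw [growthCoeff, hwalks, growthRate_congr h, growthCoeff]

theorem exists_isDominant {i j : Fin n} {r : ℕ} (h : growthRate A i j r ≠ 0) :
    ∃ u a b, IsDominant A i j r u ∧ a + b ≡ r [MOD jointCyclicity A] ∧
      pow A a i u ≠ 0 ∧ pow A b u j ≠ 0 := by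
  obtain ⟨v, t, ht, hv, hmean⟩ := exists_componentMean_eq_growthRate h
  obtain ⟨u, -, hvu, hu, -⟩ := exists_isCritical (hmean ▸ h)
  obtain ⟨t', ht', a, b, rfl, ha, hb⟩ := hv.exists_modEq hvu (jointCyclicity_pos A)
  exact ⟨u, a, b, ⟨hu, (componentMean_congr hvu).symm.trans hmean⟩, ht'.trans ht, ha, hb⟩

theorem IsDominant.growthRate_pos {i j u : Fin n} {r : ℕ} (hu : IsDominant A i j r u) :
    0 < growthRate A i j r :=
  pos_iff_ne_zero.2 (hu.2 ▸ hu.1.componentMean_ne_zero)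

theorem IsDominant.exists_short_walks {i j u : Fin n} {r a b : ℕ} (hu : IsDominant A i j r u)
    (hr : a + b ≡ r [MOD jointCyclicity A]) (ha : pow A a i u ≠ 0) (hb : pow A b u j ≠ 0) :
    ∃ a' b', (u, a', b') ∈ dominantWalks A i j r ∧ pow A a' i u ≠ 0 ∧ pow A b' u j ≠ 0 ∧
      pow A a i u * pow A b u j ≤
        pow A a' i u * pow A b' u j / growthRate A i j r ^ (a' + b') *
          growthRate A i j r ^ (a + b) := by
  obtain ⟨a', ha', hma, ha0, hla⟩ := exists_short_walk (jointCyclicity_pos A)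
    (fun w t ht hw => (hw.append hb).componentMean_le_growthRate ((ht.add_right b).trans hr)) ha
  obtain ⟨b', hb', hmb, hb0, hlb⟩ := exists_short_walk (jointCyclicity_pos A)
    (fun w t ht hw => (hw.prepend ha).componentMean_le_growthRate ((ht.add_left a).trans hr)) hb
  refine ⟨a', b', mem_dominantWalks.2 ⟨⟨ha', hb'⟩, hu, (hma.add hmb).trans hr⟩, ha0, hb0, ?_⟩
  rw [div_mul_eq_mul_div, le_div_iff₀ (pow_pos hu.growthRate_pos _)]
  calc pow A a i u * pow A b u j * growthRate A i j r ^ (a' + b')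
      = (pow A a i u * growthRate A i j r ^ a') * (pow A b u j * growthRate A i j r ^ b') := by ring
    _ ≤ (pow A a' i u * growthRate A i j r ^ a) * (pow A b' u j * growthRate A i j r ^ b) :=
        mul_le_mul' hla hlb
    _ = pow A a' i u * pow A b' u j * growthRate A i j r ^ (a + b) := by ring

theorem le_growthCoeff {i j u : Fin n} {r a b : ℕ} (h : (u, a, b) ∈ dominantWalks A i j r) :
    pow A a i u * pow A b u j / growthRate A i j r ^ (a + b) ≤ growthCoeff A i j r :=
  Finset.le_sup (f := fun p : Fin n × ℕ × ℕ =>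
    pow A p.2.1 i p.1 * pow A p.2.2 p.1 j / growthRate A i j r ^ (p.2.1 + p.2.2)) h

theorem IsDominant.mul_le_growthCoeff_mul_pow {i j u : Fin n} {r a b : ℕ}
    (hu : IsDominant A i j r u) (hr : a + b ≡ r [MOD jointCyclicity A]) :
    pow A a i u * pow A b u j ≤ growthCoeff A i j r * growthRate A i j r ^ (a + b) := by
  by_cases h : pow A a i u * pow A b u j = 0
  · exact h ▸ zero_le
  obtain ⟨a', b', hmem, -, -, hle⟩ :=
    hu.exists_short_walks hr (left_ne_zero_of_mul h) (right_ne_zero_of_mul h)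
  exact hle.trans (mul_le_mul_left (le_growthCoeff hmem) _)

theorem exists_mem_dominantWalks_of_growthCoeff_ne_zero {i j : Fin n} {r : ℕ}
    (h : growthCoeff A i j r ≠ 0) :
    ∃ u a b, (u, a, b) ∈ dominantWalks A i j r ∧
      growthCoeff A i j r = pow A a i u * pow A b u j / growthRate A i j r ^ (a + b) := by
  obtain ⟨⟨u, a, b⟩, hmem, hmax⟩ := exists_mem_eq_sup_of_ne_zero h
  exact ⟨u, a, b, hmem, hmax⟩

theorem growthCoeff_eq_zero_iff {i j : Fin n} {r : ℕ} :
    growthCoeff A i j r = 0 ↔ growthRate A i j r = 0 := by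
  refine not_iff_not.1 ⟨fun h => ?_, fun h => ?_⟩
  · obtain ⟨u, a, b, hmem, -⟩ := exists_mem_dominantWalks_of_growthCoeff_ne_zero h
    exact (mem_dominantWalks.1 hmem).2.1.growthRate_pos.ne'
  · obtain ⟨u, a, b, hu, hr, ha, hb⟩ := exists_isDominant h
    obtain ⟨a', b', hmem, ha', hb', -⟩ := hu.exists_short_walks hr ha hb
    exact ((pos_iff_ne_zero.2 (div_ne_zero (mul_ne_zero ha' hb') (pow_ne_zero _ h))).trans_le
      (le_growthCoeff hmem)).ne'

open Classical in
/-- The matrix `A` without the edges at the nodes outside `S`. -/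
noncomputable def restrict (A : Matrix (Fin n) (Fin n) ℝ≥0) (S : Set (Fin n)) :
    Matrix (Fin n) (Fin n) ℝ≥0 :=
  fun i j => if i ∈ S ∧ j ∈ S then A i j else 0

theorem restrict_le (A : Matrix (Fin n) (Fin n) ℝ≥0) (S : Set (Fin n)) (i j : Fin n) :
    restrict A S i j ≤ A i j := by
  unfold restrict
  split_ifs <;> simp

theorem pow_restrict_eq_zero {S : Set (Fin n)} {u : Fin n} (hu : u ∉ S) {b : ℕ} (hb : 0 < b)
    (i : Fin n) : pow (restrict A S) b i u = 0 := by
  obtain ⟨b, rfl⟩ := Nat.exists_eq_succ_of_ne_zero hb.ne'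
  obtain ⟨v, hv⟩ := exists_mul_apply_eq (pow (restrict A S) b) (restrict A S) i u
  rw [pow, hv, restrict, if_neg (fun h => hu h.2), mul_zero]

/-- The nodes that may occur on walks from `i` to `j` of lengths congruent to `r`, except for the
dominant ones. -/
def recessiveNodes (A : Matrix (Fin n) (Fin n) ℝ≥0) (i j : Fin n) (r : ℕ) : Set (Fin n) :=
  {u | ¬ IsDominant A i j r u ∧ componentMean A u ≤ growthRate A i j r}

theorem pow_restrict_recessiveNodes_lt {i j : Fin n} {r : ℕ} (h0 : 0 < growthRate A i j r) {b : ℕ}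
    (hb : 0 < b) (u : Fin n) :
    pow (restrict A (recessiveNodes A i j r)) b u u < growthRate A i j r ^ b := by
  by_cases hu : u ∈ recessiveNodes A i j r
  · have hle := pow_mono (restrict_le A (recessiveNodes A i j r)) b u u
    refine lt_of_not_ge fun hge => hu.1 ?_
    have hmean : componentMean A u = growthRate A i j r := le_antisymm hu.2 <|
      (pow_le_pow_iff_left₀ zero_le zero_le hb.ne').1 ((hge.trans hle).trans (pow_self_le A b u))
    refine ⟨isCritical_of_pow_eq hb (hmean ▸ h0.ne') ?_, hmean⟩
    exact le_antisymm (pow_self_le A b u) (hmean ▸ hge.trans hle)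
  · rw [pow_restrict_eq_zero hu hb]
    exact pow_pos h0 b

theorem pow_le_growthCoeff_mul_pow_or {i j : Fin n} {r t : ℕ}
    (hr : t ≡ r [MOD jointCyclicity A]) :
    pow A t i j ≤ growthCoeff A i j r * growthRate A i j r ^ t ∨
      pow A t i j ≤ pow (restrict A (recessiveNodes A i j r)) t i j := by
  by_cases h0 : pow A t i j = 0
  · exact .inl (h0 ▸ zero_le)
  obtain ⟨c, rfl, rfl, hc⟩ := exists_weight_eq_pow h0
  have hsplit : ∀ s ≤ t, pow A t (c 0) (c t) =
      pow A s (c 0) (c s) * pow A (t - s) (c s) (c t) := by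
    intro s hs
    obtain ⟨d, rfl⟩ := Nat.exists_eq_add_of_le hs
    rw [Nat.add_sub_cancel_left, pow_eq_mul_of_weight_eq hc]
  by_cases hdom : ∃ s ≤ t, IsDominant A (c 0) (c t) r (c s)
  · obtain ⟨s, hs, hdom⟩ := hdom
    have hle := hdom.mul_le_growthCoeff_mul_pow (a := s) (b := t - s)
      (by rwa [Nat.add_sub_cancel' hs])
    rw [← hsplit s hs, Nat.add_sub_cancel' hs] at hle
    exact .inl hle
  · push Not at hdom
    have hmem : ∀ s ≤ t, c s ∈ recessiveNodes A (c 0) (c t) r := fun s hs =>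
      ⟨hdom s hs, WalkThrough.componentMean_le_growthRate (t := t)
        ⟨s, t - s, Nat.add_sub_cancel' hs, left_ne_zero_of_mul (hsplit s hs ▸ h0),
          right_ne_zero_of_mul (hsplit s hs ▸ h0)⟩ hr⟩
    have hweight : weight (restrict A (recessiveNodes A (c 0) (c t) r)) t c = weight A t c :=
      Finset.prod_congr rfl fun s hs =>
        have hst := Finset.mem_range.1 hs
        if_pos ⟨hmem s hst.le, hmem (s + 1) hst⟩
    refine .inr ?_
    rw [← hc, ← hweight]
    exact weight_le_pow _ _ _

theorem eventually_growthCoeff_mul_pow_le (A : Matrix (Fin n) (Fin n) ℝ≥0) (i j : Fin n) (r : ℕ) :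
    ∀ᶠ t in atTop, t ≡ r [MOD jointCyclicity A] →
      growthCoeff A i j r * growthRate A i j r ^ t ≤ pow A t i j := by
  by_cases h0 : growthCoeff A i j r = 0
  · exact .of_forall fun t _ => by simp [h0]
  obtain ⟨u, a, b, hmem, hmax⟩ := exists_mem_dominantWalks_of_growthCoeff_ne_zero h0
  obtain ⟨-, ⟨hcrit, hmean⟩, hab⟩ := mem_dominantWalks.1 hmem
  obtain ⟨N, hN⟩ := hcrit.exists_forall_pow_self_eq
  filter_upwards [eventually_ge_atTop (a + b + N)] with t ht hr
  obtain ⟨d, rfl⟩ := Nat.exists_eq_add_of_le (show a + b ≤ t by omega)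
  have hdvd : jointCyclicity A ∣ d := Nat.modEq_zero_iff_dvd.1 <|
    Nat.ModEq.add_left_cancel' (a + b)
      (show a + b + d ≡ a + b + 0 [MOD jointCyclicity A] from hr.trans hab.symm)
  have hclosed := hN d (by omega) hdvd
  rw [hmean] at hclosed
  have hpos : growthRate A i j r ^ (a + b) ≠ 0 :=
    pow_ne_zero _ (mt growthCoeff_eq_zero_iff.2 h0)
  calc growthCoeff A i j r * growthRate A i j r ^ (a + b + d)
      = pow A a i u * pow A b u j * growthRate A i j r ^ d := by
        rw [hmax, _root_.pow_add _ (a + b) d, ← mul_assoc, div_mul_cancel₀ _ hpos]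
    _ = pow A a i u * (pow A d u u * pow A b u j) := by rw [hclosed]; ring
    _ ≤ pow A a i u * pow A (d + b) u j := by gcongr; exact le_pow_add _ _ _ _ _ _
    _ ≤ pow A (a + (d + b)) i j := le_pow_add _ _ _ _ _ _
    _ = pow A (a + b + d) i j := by congr 1; ring

theorem eventually_pow_le_growthCoeff_mul_pow (A : Matrix (Fin n) (Fin n) ℝ≥0) (i j : Fin n)
    (r : ℕ) :
    ∀ᶠ t in atTop, t ≡ r [MOD jointCyclicity A] →
      pow A t i j ≤ growthCoeff A i j r * growthRate A i j r ^ t := by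
  by_cases h0 : growthRate A i j r = 0
  · filter_upwards [eventually_ge_atTop n] with t ht hr
    rw [pow_eq_zero_of_growthRate_eq_zero ht ((growthRate_congr hr).trans h0)]
    exact zero_le
  · have h0' := pos_iff_ne_zero.2 h0
    filter_upwards [eventually_pow_le_mul_pow h0'
      (fun b u hb _ => pow_restrict_recessiveNodes_lt h0' hb u)
      (pos_iff_ne_zero.2 (mt growthCoeff_eq_zero_iff.1 h0))] with t ht hr
    exact (pow_le_growthCoeff_mul_pow_or hr).elim id fun hle => hle.trans (ht i j)

theorem eventually_of_forall_modEq {g : ℕ} (hg : 0 < g) {p : ℕ → Prop}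
    (h : ∀ r, ∀ᶠ t in atTop, t ≡ r [MOD g] → p t) : ∀ᶠ t in atTop, p t := by
  filter_upwards [(eventually_all_finset (Finset.range g)).2 fun r _ => h r] with t ht
  exact ht (t % g) (Finset.mem_range.2 (Nat.mod_lt _ hg)) (Nat.mod_modEq t g).symm

theorem eventually_pow_eq (A : Matrix (Fin n) (Fin n) ℝ≥0) :
    ∀ᶠ t in atTop, ∀ i j, pow A t i j = growthCoeff A i j t * growthRate A i j t ^ t := by
  refine eventually_all.2 fun i => eventually_all.2 fun j =>
    eventually_of_forall_modEq (jointCyclicity_pos A) fun r => ?_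
  filter_upwards [eventually_pow_le_growthCoeff_mul_pow A i j r,
    eventually_growthCoeff_mul_pow_le A i j r] with t hle hge hr
  rw [growthCoeff_congr hr, growthRate_congr hr]
  exact le_antisymm (hle hr) (hge hr)

end Asymptotics

/-! ### Orbit periodicity in terms of growth rates -/

/-- The function `f` takes at most one nonzero value. -/
def ConstOnSupport {α M : Type*} [Zero M] (f : α → M) : Prop :=
  ∀ ⦃x y⦄, f x ≠ 0 → f y ≠ 0 → f x = f y

theorem ConstOnSupport.exists_forall_eq {α M : Type*} [Zero M] {f : α → M}
    (h : ConstOnSupport f) : ∃ c, ∀ x, f x ≠ 0 → f x = c := by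
  by_cases hf : ∃ x, f x ≠ 0
  · obtain ⟨x, hx⟩ := hf
    exact ⟨f x, fun y hy => h hy hx⟩
  · push Not at hf
    exact ⟨0, fun y _ => hf y⟩

section Orbits

open Filter

variable {n : ℕ} {A : Matrix (Fin n) (Fin n) ℝ≥0} {y : Fin n → ℝ≥0}

open Classical in
/-- The growth rate of the entry `i` of the orbit `A ^ t ⊗ y` for `t` congruent to `r` modulo the
joint cyclicity. -/
noncomputable def orbitRate (A : Matrix (Fin n) (Fin n) ℝ≥0) (y : Fin n → ℝ≥0) (i : Fin n)
    (r : ℕ) : ℝ≥0 :=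
  (Finset.univ.filter fun j => y j ≠ 0).sup fun j => growthRate A i j r

theorem growthRate_le_orbitRate {j : Fin n} (hj : y j ≠ 0) (i : Fin n) (r : ℕ) :
    growthRate A i j r ≤ orbitRate A y i r :=
  Finset.le_sup (f := fun j => growthRate A i j r) (by simpa using hj)

theorem exists_growthRate_eq_orbitRate {i : Fin n} {r : ℕ} (h : orbitRate A y i r ≠ 0) :
    ∃ k, y k ≠ 0 ∧ growthRate A i k r = orbitRate A y i r := by
  classical
  obtain ⟨k, hk, hmax⟩ := exists_mem_eq_sup_of_ne_zero h
  exact ⟨k, (Finset.mem_filter.1 hk).2, hmax.symm⟩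

theorem orbitRate_congr {i : Fin n} {r s : ℕ} (h : r ≡ s [MOD jointCyclicity A]) :
    orbitRate A y i r = orbitRate A y i s :=
  Finset.sup_congr rfl fun _ _ => growthRate_congr h

theorem eventually_pow_mul_le_pow_mul (A : Matrix (Fin n) (Fin n) ℝ≥0) (y : Fin n → ℝ≥0)
    (i j k : Fin n) :
    ∀ᶠ t in atTop, y k ≠ 0 → growthRate A i j t < growthRate A i k t →
      pow A t i j * y j ≤ pow A t i k * y k := by
  refine eventually_of_forall_modEq (jointCyclicity_pos A) fun r => ?_
  by_cases h : y k ≠ 0 ∧ growthRate A i j r < growthRate A i k r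
  · have hcoeff : growthCoeff A i k r ≠ 0 := mt growthCoeff_eq_zero_iff.1 (bot_lt_of_lt h.2).ne'
    filter_upwards [eventually_pow_eq A, eventually_mul_pow_le h.2 (growthCoeff A i j r * y j)
      (pos_iff_ne_zero.2 (mul_ne_zero hcoeff h.1))] with t ht hle hr _ _
    rw [ht, ht, growthRate_congr hr, growthRate_congr hr, growthCoeff_congr hr,
      growthCoeff_congr hr, mul_right_comm, mul_right_comm (growthCoeff A i k r)]
    exact hle
  · refine .of_forall fun t hr hk hlt => absurd ⟨hk, ?_⟩ h
    rwa [growthRate_congr hr, growthRate_congr hr] at hlt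

theorem eventually_pow_add_jointCyclicity (A : Matrix (Fin n) (Fin n) ℝ≥0) :
    ∀ᶠ t in atTop, ∀ i j, pow A (t + jointCyclicity A) i j =
      growthRate A i j t ^ jointCyclicity A * pow A t i j := by
  filter_upwards [eventually_pow_eq A,
    (tendsto_add_atTop_nat (jointCyclicity A)).eventually (eventually_pow_eq A)] with t ht ht' i j
  have hshift : t + jointCyclicity A ≡ t [MOD jointCyclicity A] := by simp [Nat.ModEq]
  rw [ht', ht, growthCoeff_congr hshift, growthRate_congr hshift]
  ring

theorem eventually_mulVec_pow_eq (A : Matrix (Fin n) (Fin n) ℝ≥0) (y : Fin n → ℝ≥0) :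
    ∀ᶠ t in atTop, ∀ i, orbitRate A y i t ≠ 0 → ∃ k, y k ≠ 0 ∧
      growthRate A i k t = orbitRate A y i t ∧
      mulVec (pow A t) y i = pow A t i k * y k := by
  have hdom : ∀ᶠ t in atTop, ∀ i j k, y k ≠ 0 → growthRate A i j t < growthRate A i k t →
      pow A t i j * y j ≤ pow A t i k * y k :=
    eventually_all.2 fun i => eventually_all.2 fun j => eventually_all.2 fun k =>
      eventually_pow_mul_le_pow_mul A y i j k
  filter_upwards [hdom] with t ht i h0
  obtain ⟨l, hl, hlrate⟩ := exists_growthRate_eq_orbitRate h0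
  obtain ⟨m, -, hm⟩ := Finset.exists_mem_eq_sup Finset.univ ⟨i, Finset.mem_univ i⟩
    fun j => pow A t i j * y j
  have hml : pow A t i l * y l ≤ pow A t i m * y m :=
    hm ▸ Finset.le_sup (f := fun j => pow A t i j * y j) (Finset.mem_univ l)
  by_cases hym : y m ≠ 0 ∧ growthRate A i m t = orbitRate A y i t
  · exact ⟨m, hym.1, hym.2, hm⟩
  refine ⟨l, hl, hlrate, hm.trans (le_antisymm ?_ hml)⟩
  by_cases hm0 : y m = 0
  · simp [hm0]
  · exact ht i m l hl (hlrate ▸ (growthRate_le_orbitRate hm0 i t).lt_of_ne fun h => hym ⟨hm0, h⟩)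

theorem eventually_mulVec_pow_eq_zero_iff (A : Matrix (Fin n) (Fin n) ℝ≥0) (y : Fin n → ℝ≥0) :
    ∀ᶠ t in atTop, ∀ i, mulVec (pow A t) y i = 0 ↔ orbitRate A y i t = 0 := by
  filter_upwards [eventually_pow_eq A, eventually_mulVec_pow_eq A y] with t ht hmax i
  refine ⟨fun h => by_contra fun h0 => ?_, fun h => le_zero_iff.1 (Finset.sup_le fun j _ => ?_)⟩
  · obtain ⟨k, hk, hrate, heq⟩ := hmax i h0
    rw [heq, ht, hrate] at h
    exact mul_ne_zero (mul_ne_zero (mt growthCoeff_eq_zero_iff.1 (hrate ▸ h0)) (pow_ne_zero t h0))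
      hk h
  · by_cases hj : y j = 0
    · simp [hj]
    · have hrate : growthRate A i j t = 0 := le_zero_iff.1 (h ▸ growthRate_le_orbitRate hj i t)
      rw [ht, growthCoeff_eq_zero_iff.2 hrate, zero_mul, zero_mul]

theorem eventually_mulVec_pow_add (A : Matrix (Fin n) (Fin n) ℝ≥0) (y : Fin n → ℝ≥0) :
    ∀ᶠ t in atTop, ∀ i, mulVec (pow A (t + jointCyclicity A)) y i =
      orbitRate A y i t ^ jointCyclicity A * mulVec (pow A t) y i := by
  have hshift := tendsto_add_atTop_nat (jointCyclicity A)
  filter_upwards [eventually_pow_add_jointCyclicity A, eventually_mulVec_pow_eq A y,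
    hshift.eventually (eventually_mulVec_pow_eq A y), eventually_mulVec_pow_eq_zero_iff A y,
    hshift.eventually (eventually_mulVec_pow_eq_zero_iff A y)] with t hstep hmax hmax' h0 h0' i
  have hrate : orbitRate A y i (t + jointCyclicity A) = orbitRate A y i t :=
    orbitRate_congr (by simp [Nat.ModEq])
  by_cases h : orbitRate A y i t = 0
  · rw [(h0 i).2 h, (h0' i).2 (hrate.trans h), mul_zero]
  have hle : ∀ s k, pow A s i k * y k ≤ mulVec (pow A s) y i := fun s k =>
    Finset.le_sup (f := fun j => pow A s i j * y j) (Finset.mem_univ k)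
  obtain ⟨k, -, hk, hkt⟩ := hmax i h
  obtain ⟨l, -, hl, hlt⟩ := hmax' i (hrate ▸ h)
  rw [growthRate_congr (s := t) (by simp [Nat.ModEq]), hrate] at hl
  refine le_antisymm ?_ ?_
  · rw [hlt, hstep, hl, mul_assoc]
    exact mul_le_mul_right (hle t l) _
  · rw [hkt, ← hk, ← mul_assoc, ← hstep]
    exact hle _ k

theorem exists_modEq_of_eventually {p : ℕ → Prop} (h : ∀ᶠ t in atTop, p t) {g : ℕ} (hg : 0 < g)
    (r : ℕ) : ∃ t, t ≡ r [MOD g] ∧ p t := by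
  obtain ⟨T, hT⟩ := eventually_atTop.1 h
  exact ⟨r + g * T, by simp [Nat.ModEq],
    hT _ ((Nat.le_mul_of_pos_left T hg).trans (Nat.le_add_left _ r))⟩

theorem orbitPeriodic_iff_orbitRate :
    OrbitPeriodic A ↔ ∀ y, ConstOnSupport fun p : Fin n × ℕ => orbitRate A y p.1 p.2 := by
  refine ⟨fun h y => ?_, fun h y => ?_⟩
  · obtain ⟨c, T, hc⟩ := h y
    suffices hrate : ∀ i r, orbitRate A y i r ≠ 0 → orbitRate A y i r = c from
      fun p q hp hq => (hrate _ _ hp).trans (hrate _ _ hq).symm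
    intro i r h0
    obtain ⟨t, hr, ht, hadd, hzero⟩ := exists_modEq_of_eventually
      ((eventually_ge_atTop T).and ((eventually_mulVec_pow_add A y).and
        (eventually_mulVec_pow_eq_zero_iff A y))) (jointCyclicity_pos A) r
    have hpow : orbitRate A y i t ^ jointCyclicity A * mulVec (pow A t) y i =
        c ^ jointCyclicity A * mulVec (pow A t) y i := by
      rw [← hadd, hc t ht, Pi.smul_apply, smul_eq_mul]
    rw [← orbitRate_congr hr] at h0 ⊢
    exact (pow_left_inj₀ zero_le zero_le (jointCyclicity_pos A).ne').1
      (mul_right_cancel₀ (mt (hzero i).1 h0) hpow)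
  · obtain ⟨c, hc⟩ := (h y).exists_forall_eq
    obtain ⟨T, hT⟩ := eventually_atTop.1
      ((eventually_mulVec_pow_add A y).and (eventually_mulVec_pow_eq_zero_iff A y))
    refine ⟨c, T, fun t ht => funext fun i => ?_⟩
    rw [(hT t ht).1 i, Pi.smul_apply, smul_eq_mul]
    by_cases h0 : orbitRate A y i t = 0
    · rw [((hT t ht).2 i).2 h0, mul_zero, mul_zero]
    · rw [hc (i, t) h0]

theorem orbitPeriodic_iff_growthRate :
    OrbitPeriodic A ↔ ∀ j k, ConstOnSupport fun p : Fin n × ℕ =>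
      max (growthRate A p.1 j p.2) (growthRate A p.1 k p.2) := by
  classical
  rw [orbitPeriodic_iff_orbitRate]
  refine ⟨fun h j k => ?_, fun h y p q hp hq => ?_⟩
  · let y : Fin n → ℝ≥0 := fun l => if l = j ∨ l = k then 1 else 0
    have hsupport : (Finset.univ.filter fun l => y l ≠ 0) = {j, k} := by
      ext l
      simp only [y, Finset.mem_filter, Finset.mem_univ, true_and, Finset.mem_insert,
        Finset.mem_singleton, ne_eq, ite_eq_right_iff, one_ne_zero, imp_false, not_not]
    have hrate : ∀ i r, orbitRate A y i r = max (growthRate A i j r) (growthRate A i k r) := by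
      intro i r
      rw [orbitRate, hsupport, Finset.sup_insert, Finset.sup_singleton]
    simpa only [hrate] using h y
  · obtain ⟨k, hk, hkp⟩ := exists_growthRate_eq_orbitRate hp
    obtain ⟨l, hl, hlq⟩ := exists_growthRate_eq_orbitRate hq
    have hkl := h k l (x := p) (y := q)
    simp only [hkp, hlq, max_eq_left (growthRate_le_orbitRate hl _ _),
      max_eq_right (growthRate_le_orbitRate hk _ _)] at hkl
    exact hkl hp hq

end Orbits

/-! ### A finite criterion -/

section Criterion

variable {n : ℕ} {A : Matrix (Fin n) (Fin n) ℝ≥0}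

/-- The power with exponent `n!` of the largest geometric mean of the closed walks of length at
most `n` at `v`. The exponent makes it computable without roots. -/
noncomputable def nodeMeanPow (A : Matrix (Fin n) (Fin n) ℝ≥0) (v : Fin n) : ℝ≥0 :=
  (Finset.range n).sup fun k => pow A (k + 1) v v ^ ∏ m ∈ (Finset.range n).erase k, (m + 1)

open Classical in
/-- The entry `i, j` is the largest value of `nodeMeanPow` at the nodes on walks of length `t` from
`i` to `j`. -/
noncomputable def walkMeanPow (A : Matrix (Fin n) (Fin n) ℝ≥0) (t : ℕ) :
    Matrix (Fin n) (Fin n) ℝ≥0 :=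
  fun i j => (Finset.univ.filter fun u => WalkThrough A i u j t).sup (nodeMeanPow A)

theorem succ_mul_prod_erase {k : ℕ} (hk : k < n) :
    (k + 1) * ∏ m ∈ (Finset.range n).erase k, (m + 1) = n.factorial := by
  rw [Finset.mul_prod_erase (Finset.range n) (fun m => m + 1) (Finset.mem_range.2 hk),
    Finset.prod_range_add_one_eq_factorial]

theorem le_nodeMeanPow {k : ℕ} (hk : k < n) (A : Matrix (Fin n) (Fin n) ℝ≥0) (v : Fin n) :
    pow A (k + 1) v v ^ ∏ m ∈ (Finset.range n).erase k, (m + 1) ≤ nodeMeanPow A v :=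
  Finset.le_sup (f := fun k => pow A (k + 1) v v ^ ∏ m ∈ (Finset.range n).erase k, (m + 1))
    (Finset.mem_range.2 hk)

theorem nodeMeanPow_le (A : Matrix (Fin n) (Fin n) ℝ≥0) (v : Fin n) :
    nodeMeanPow A v ≤ componentMean A v ^ n.factorial := by
  refine Finset.sup_le fun k hk => ?_
  rw [← succ_mul_prod_erase (Finset.mem_range.1 hk), pow_mul]
  exact pow_le_pow_left' (pow_self_le A (k + 1) v) _

theorem nodeMeanPow_eq {k : ℕ} {v : Fin n} (hk : 0 < k) (hkn : k ≤ n)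
    (h : pow A k v v = componentMean A v ^ k) :
    nodeMeanPow A v = componentMean A v ^ n.factorial := by
  obtain ⟨k, rfl⟩ := Nat.exists_eq_succ_of_ne_zero hk.ne'
  refine le_antisymm (nodeMeanPow_le A v) ?_
  rw [← succ_mul_prod_erase hkn, pow_mul, ← h]
  exact le_nodeMeanPow hkn A v

theorem nodeMeanPow_ne_zero_iff {v : Fin n} :
    nodeMeanPow A v ≠ 0 ↔ ∃ k, 0 < k ∧ k ≤ n ∧ pow A k v v ≠ 0 := by
  constructor
  · refine fun h => by_contra fun hk => h (le_zero_iff.1 (Finset.sup_le fun k hkn => ?_))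
    push Not at hk
    rw [hk (k + 1) k.succ_pos (Finset.mem_range.1 hkn), zero_pow]
    exact (Finset.prod_pos fun m _ => Nat.succ_pos m).ne'
  · rintro ⟨k, hk, hkn, h⟩
    obtain ⟨k, rfl⟩ := Nat.exists_eq_succ_of_ne_zero hk.ne'
    exact ((pow_pos h.bot_lt _).trans_le (le_nodeMeanPow hkn A v)).ne'

theorem WalkThrough.le_walkMeanPow {i u j : Fin n} {t : ℕ} (h : WalkThrough A i u j t) :
    nodeMeanPow A u ≤ walkMeanPow A t i j :=
  Finset.le_sup (f := nodeMeanPow A) (by simpa using h)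

theorem walkMeanPow_le {i j : Fin n} {t : ℕ} {x : ℝ≥0}
    (h : ∀ u, WalkThrough A i u j t → nodeMeanPow A u ≤ x) : walkMeanPow A t i j ≤ x :=
  Finset.sup_le fun u hu => h u (by simpa using hu)

/-- Both halves of the walk can be shortened to less than `n * L` steps; closed walks at `i` then
make up for the missing length. -/
theorem WalkThrough.of_modEq {i u j : Fin n} {s t L : ℕ} (h : WalkThrough A i u j s) (hL : 0 < L)
    (hi : pow A L i i ≠ 0) (hm : s ≡ t [MOD L]) (ht : 2 * (n * L) ≤ t) :
    WalkThrough A i u j t := by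
  obtain ⟨a, b, rfl, ha, hb⟩ := h
  have hmean : ∀ w, componentMean A w ≤ Finset.univ.sup (componentMean A) :=
    fun w => Finset.le_sup (Finset.mem_univ w)
  obtain ⟨a', ha', hma, ha0, -⟩ := exists_short_walk hL (fun w _ _ _ => hmean w) ha
  obtain ⟨b', hb', hmb, hb0, -⟩ := exists_short_walk hL (fun w _ _ _ => hmean w) hb
  obtain ⟨m, hm⟩ := (Nat.modEq_iff_dvd' (show a' + b' ≤ t by omega)).1 ((hma.add hmb).trans hm)
  obtain rfl : L * m + (a' + b') = t := by omega
  rw [mul_comm L]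
  exact WalkThrough.prepend (pow_mul_ne_zero hi m) ⟨a', b', rfl, ha0, hb0⟩

theorem exists_mul_add_modEq {a t g L : ℕ} (hg : 0 < g) (hL : 0 < L) (h : a ≡ t [MOD g]) (N : ℕ) :
    ∃ m ≥ N, m * g + a ≡ t [MOD L] := by
  have hle : a + N ≤ g * (a + N) := Nat.le_mul_of_pos_left _ hg
  have hle' : g * (a + N) ≤ L * (g * (a + N)) := Nat.le_mul_of_pos_left _ hL
  obtain ⟨m, hm⟩ := (Nat.modEq_iff_dvd' (show a ≤ t + g * (L * (a + N)) by
    rw [mul_left_comm]; omega)).1 (h.trans (by simp [Nat.ModEq]))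
  rw [mul_left_comm] at hm
  refine ⟨m, (Nat.mul_le_mul_left_iff hg).1 ?_, ?_⟩
  · have hgN : g * (a + N) = g * a + g * N := mul_add _ _ _
    have hga : a ≤ g * a := Nat.le_mul_of_pos_left _ hg
    omega
  · rw [show m * g + a = t + L * (g * (a + N)) by rw [mul_comm m]; omega]
    simp [Nat.ModEq]

theorem walkMeanPow_le_growthRate_pow {i j : Fin n} {L s t : ℕ} (hL : 0 < L)
    (hi : pow A L i i ≠ 0) (hm : s ≡ t [MOD L]) :
    walkMeanPow A s i j ≤ growthRate A i j t ^ n.factorial := by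
  refine walkMeanPow_le fun u hu => (nodeMeanPow_le A u).trans (pow_le_pow_left' ?_ _)
  obtain ⟨m, -, hmt⟩ := exists_mul_add_modEq hL (jointCyclicity_pos A) hm 0
  exact (hu.prepend (pow_mul_ne_zero hi m)).componentMean_le_growthRate hmt

theorem growthRate_pow_le_walkMeanPow {i j : Fin n} {L s t : ℕ} (hL : 0 < L)
    (hi : pow A L i i ≠ 0) (hm : s ≡ t [MOD L]) (hs : 2 * (n * L) ≤ s) :
    growthRate A i j t ^ n.factorial ≤ walkMeanPow A s i j := by
  by_cases h0 : growthRate A i j t = 0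
  · rw [h0, zero_pow (Nat.factorial_ne_zero n)]
    exact zero_le
  obtain ⟨v, a, ha, hv, hmean⟩ := exists_componentMean_eq_growthRate h0
  obtain ⟨u, k, hvu, hu, hk, hkn, hku⟩ := exists_isCritical (hmean ▸ h0)
  obtain ⟨b, hb, hub⟩ := hv.exists_modEq hvu (jointCyclicity_pos A)
  obtain ⟨N, hN⟩ := hu.exists_forall_pow_self_eq
  obtain ⟨m, hNm, hmt⟩ := exists_mul_add_modEq (jointCyclicity_pos A) hL (hb.trans ha) N
  have hclosed : pow A (m * jointCyclicity A) u u ≠ 0 := by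
    rw [hN _ (hNm.trans (Nat.le_mul_of_pos_right m (jointCyclicity_pos A))) (dvd_mul_left _ _)]
    exact pow_ne_zero _ hu.componentMean_ne_zero
  have hlong : WalkThrough A i u j s :=
    (hub.insert hclosed).of_modEq hL hi (by rw [add_comm]; exact hmt.trans hm.symm) hs
  rw [componentMean_congr hvu] at hku
  rw [← hmean, componentMean_congr hvu, ← nodeMeanPow_eq hk hkn hku]
  exact hlong.le_walkMeanPow

theorem walkMeanPow_eq_growthRate_pow {i j : Fin n} {L s t : ℕ} (hL : 0 < L) (hLn : L ≤ n)
    (hi : pow A L i i ≠ 0) (hm : s ≡ t [MOD L]) (hs : 2 * n ^ 2 ≤ s) :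
    walkMeanPow A s i j = growthRate A i j t ^ n.factorial :=
  le_antisymm (walkMeanPow_le_growthRate_pow hL hi hm) <|
    growthRate_pow_le_walkMeanPow hL hi hm <| hs.trans' <| by
      rw [pow_two]
      gcongr

theorem growthRate_le_of_pow_ne_zero {i u j : Fin n} {a b r : ℕ} (ha : pow A a i u ≠ 0)
    (hr : a + b ≡ r [MOD jointCyclicity A]) : growthRate A u j b ≤ growthRate A i j r := by
  by_cases h0 : growthRate A u j b = 0
  · exact h0 ▸ zero_le
  obtain ⟨w, c, hc, hw, hmean⟩ := exists_componentMean_eq_growthRate h0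
  exact hmean ▸ (hw.prepend ha).componentMean_le_growthRate ((hc.add_left a).trans hr)

theorem exists_max_growthRate_eq {i j k : Fin n} {r : ℕ}
    (h : max (growthRate A i j r) (growthRate A i k r) ≠ 0) :
    ∃ v s, nodeMeanPow A v ≠ 0 ∧ max (growthRate A v j s) (growthRate A v k s) =
      max (growthRate A i j r) (growthRate A i k r) := by
  wlog hjk : growthRate A i k r ≤ growthRate A i j r generalizing j k
  · simpa only [max_comm] using this (j := k) (k := j) (by rwa [max_comm]) (le_of_not_ge hjk)
  rw [max_eq_left hjk] at h ⊢
  obtain ⟨v, t, ht, hv, hmean⟩ := exists_componentMean_eq_growthRate h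
  obtain ⟨u, L, hvu, -, hL, hLn, hLu⟩ := exists_isCritical (hmean ▸ h)
  obtain ⟨t', ht', a, b, rfl, ha, hb⟩ := hv.exists_modEq hvu (jointCyclicity_pos A)
  have hle : ∀ x, growthRate A u x b ≤ growthRate A i x r := fun x =>
    growthRate_le_of_pow_ne_zero ha (ht'.trans ht)
  have hge : growthRate A i j r ≤ growthRate A u j b := by
    rw [← hmean, componentMean_congr hvu]
    exact WalkThrough.componentMean_le_growthRate (t := b)
      ⟨0, b, zero_add b, by simp [pow], hb⟩ rfl
  refine ⟨u, b, nodeMeanPow_ne_zero_iff.2 ⟨L, hL, hLn, hLu ▸ pow_ne_zero _ (hmean ▸ h)⟩, ?_⟩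
  exact le_antisymm (max_le (hle j) ((hle k).trans hjk)) (le_max_of_le_left hge)

theorem max_pow_eq (x y : ℝ≥0) (N : ℕ) : max (x ^ N) (y ^ N) = max x y ^ N :=
  ((pow_left_mono N).map_max).symm

theorem max_walkMeanPow_eq {v : Fin n} {L s t : ℕ} (hL : 0 < L) (hLn : L ≤ n)
    (hv : pow A L v v ≠ 0) (hm : s ≡ t [MOD L]) (hs : 2 * n ^ 2 ≤ s) (j k : Fin n) :
    max (walkMeanPow A s v j) (walkMeanPow A s v k) =
      max (growthRate A v j t) (growthRate A v k t) ^ n.factorial := by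
  rw [walkMeanPow_eq_growthRate_pow hL hLn hv hm hs, walkMeanPow_eq_growthRate_pow hL hLn hv hm hs,
    max_pow_eq]

theorem exists_lt_add_modEq (t T : ℕ) {L : ℕ} (hL : 0 < L) : ∃ s < L, T + s ≡ t [MOD L] := by
  obtain ⟨m, -, hm⟩ := exists_mul_add_modEq one_pos hL (Nat.modEq_one (a := T) (b := t)) 0
  rw [mul_one, add_comm] at hm
  exact ⟨m % L, Nat.mod_lt _ hL, ((Nat.mod_modEq m L).add_left T).trans hm⟩

/-- The values of `walkMeanPow` determine the growth rates on the rows that belong to nodes on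
cycles, where they are periodic beyond `2 * n ^ 2` with a period of at most `n`. -/
theorem orbitPeriodic_iff_walkMeanPow {T : ℕ} (hT : 2 * n ^ 2 ≤ T) :
    OrbitPeriodic A ↔ ∀ j k, ConstOnSupport fun p : {v // nodeMeanPow A v ≠ 0} × Fin n =>
      max (walkMeanPow A (T + p.2) p.1 j) (walkMeanPow A (T + p.2) p.1 k) := by
  have hf := Nat.factorial_ne_zero n
  rw [orbitPeriodic_iff_growthRate]
  refine forall₂_congr fun j k => ⟨?_, ?_⟩
  · rintro h ⟨⟨v, hv⟩, s⟩ ⟨⟨w, hw⟩, t⟩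
    obtain ⟨L, hL, hLn, hLv⟩ := nodeMeanPow_ne_zero_iff.1 hv
    obtain ⟨M, hM, hMn, hMw⟩ := nodeMeanPow_ne_zero_iff.1 hw
    simp only [max_walkMeanPow_eq hL hLn hLv rfl (le_add_right hT),
      max_walkMeanPow_eq hM hMn hMw rfl (le_add_right hT), pow_ne_zero_iff hf]
    exact fun h1 h2 => congrArg (· ^ n.factorial) (@h (v, T + s) (w, T + t) h1 h2)
  · have hrow : ∀ i r, max (growthRate A i j r) (growthRate A i k r) ≠ 0 →
        ∃ p : {v // nodeMeanPow A v ≠ 0} × Fin n,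
          max (walkMeanPow A (T + p.2) p.1 j) (walkMeanPow A (T + p.2) p.1 k) =
            max (growthRate A i j r) (growthRate A i k r) ^ n.factorial := by
      intro i r h0
      obtain ⟨v, t, hv, heq⟩ := exists_max_growthRate_eq h0
      obtain ⟨L, hL, hLn, hLv⟩ := nodeMeanPow_ne_zero_iff.1 hv
      obtain ⟨s, hs, hst⟩ := exists_lt_add_modEq t T hL
      exact ⟨(⟨v, hv⟩, ⟨s, hs.trans_le hLn⟩),
        heq ▸ max_walkMeanPow_eq hL hLn hLv hst (le_add_right hT) j k⟩
    rintro h ⟨i, r⟩ ⟨i', r'⟩ h1 h2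
    obtain ⟨p, hp⟩ := hrow i r h1
    obtain ⟨q, hq⟩ := hrow i' r' h2
    have heq := h (hp.trans_ne (pow_ne_zero _ h1)) (hq.trans_ne (pow_ne_zero _ h2))
    exact (pow_left_inj₀ zero_le zero_le hf).1 ((hp.symm.trans heq).trans hq)

open Classical in
/-- The zero-one matrix of the pairs of nodes connected by a walk of length `t`. -/
noncomputable def reach (A : Matrix (Fin n) (Fin n) ℝ≥0) (t : ℕ) :
    Matrix (Fin n) (Fin n) ℝ≥0 :=
  fun i j => if pow A t i j = 0 then 0 else 1

theorem reach_eq_zero {i j : Fin n} {t : ℕ} (h : pow A t i j = 0) : reach A t i j = 0 :=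
  if_pos h

theorem reach_eq_one {i j : Fin n} {t : ℕ} (h : pow A t i j ≠ 0) : reach A t i j = 1 :=
  if_neg h

theorem reach_le_one (A : Matrix (Fin n) (Fin n) ℝ≥0) (t : ℕ) (i j : Fin n) :
    reach A t i j ≤ 1 := by
  unfold reach
  split_ifs <;> simp

theorem reach_one (A : Matrix (Fin n) (Fin n) ℝ≥0) (i j : Fin n) :
    reach A 1 i j = if A i j ≤ 0 then 0 else 1 := by
  simp only [reach, MaxAlg.pow_one, nonpos_iff_eq_zero]

theorem reach_add (A : Matrix (Fin n) (Fin n) ℝ≥0) (s t : ℕ) :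
    reach A (s + t) = mul (reach A s) (reach A t) := by
  funext i j
  refine le_antisymm ?_ (Finset.sup_le fun u _ => ?_)
  · by_cases h : pow A (s + t) i j = 0
    · exact reach_eq_zero h ▸ zero_le
    · obtain ⟨u, hu⟩ := exists_pow_add_eq A s t i j
      have hle := le_mul_apply (reach A s) (reach A t) i u j
      rw [hu] at h
      rw [reach_eq_one (left_ne_zero_of_mul h), reach_eq_one (right_ne_zero_of_mul h),
        one_mul] at hle
      exact (reach_le_one A _ i j).trans hle
  · by_cases hs : pow A s i u = 0
    · simp [reach_eq_zero hs]
    by_cases ht : pow A t u j = 0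
    · simp [reach_eq_zero ht]
    simp [reach_eq_one hs, reach_eq_one ht, reach_eq_one (pow_add_ne_zero hs ht)]

theorem walkMeanPow_mul_reach_le (A : Matrix (Fin n) (Fin n) ℝ≥0) (s t : ℕ) (i k j : Fin n) :
    walkMeanPow A s i k * reach A t k j ≤ walkMeanPow A (s + t) i j := by
  by_cases h : pow A t k j = 0
  · simp [reach_eq_zero h]
  · rw [reach_eq_one h, mul_one]
    exact walkMeanPow_le fun u hu => (hu.append h).le_walkMeanPow

theorem reach_mul_walkMeanPow_le (A : Matrix (Fin n) (Fin n) ℝ≥0) (s t : ℕ) (i k j : Fin n) :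
    reach A s i k * walkMeanPow A t k j ≤ walkMeanPow A (s + t) i j := by
  by_cases h : pow A s i k = 0
  · simp [reach_eq_zero h]
  · rw [reach_eq_one h, one_mul]
    exact walkMeanPow_le fun u hu => (hu.prepend h).le_walkMeanPow

theorem walkMeanPow_add (A : Matrix (Fin n) (Fin n) ℝ≥0) (s t : ℕ) (i j : Fin n) :
    walkMeanPow A (s + t) i j =
      max (mul (walkMeanPow A s) (reach A t) i j) (mul (reach A s) (walkMeanPow A t) i j) := by
  refine le_antisymm (walkMeanPow_le ?_)
    (max_le (Finset.sup_le fun k _ => walkMeanPow_mul_reach_le A s t i k j)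
      (Finset.sup_le fun k _ => reach_mul_walkMeanPow_le A s t i k j))
  rintro u ⟨a, b, hab, ha, hb⟩
  rcases le_total a s with h | h
  · obtain ⟨c, rfl⟩ := Nat.exists_eq_add_of_le h
    obtain rfl : b = c + t := by omega
    obtain ⟨w, hw⟩ := exists_pow_add_eq A c t u j
    rw [hw] at hb
    refine le_max_of_le_left (le_trans ?_ (le_mul_apply _ _ i w j))
    rw [reach_eq_one (right_ne_zero_of_mul hb), mul_one]
    exact WalkThrough.le_walkMeanPow ⟨a, c, rfl, ha, left_ne_zero_of_mul hb⟩
  · obtain ⟨c, rfl⟩ := Nat.exists_eq_add_of_le h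
    obtain rfl : t = c + b := by omega
    obtain ⟨w, hw⟩ := exists_pow_add_eq A s c i u
    rw [hw] at ha
    refine le_max_of_le_right (le_trans ?_ (le_mul_apply _ _ i w j))
    rw [reach_eq_one (left_ne_zero_of_mul ha), one_mul]
    exact WalkThrough.le_walkMeanPow ⟨c, b, rfl, right_ne_zero_of_mul ha, hb⟩

theorem walkMeanPow_one (A : Matrix (Fin n) (Fin n) ℝ≥0) (i j : Fin n) :
    walkMeanPow A 1 i j =
      max (nodeMeanPow A i * reach A 1 i j) (nodeMeanPow A j * reach A 1 i j) := by
  refine le_antisymm (walkMeanPow_le ?_) ?_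
  · rintro u ⟨a, b, hab, ha, hb⟩
    obtain ⟨rfl, rfl⟩ | ⟨rfl, rfl⟩ : a = 0 ∧ b = 1 ∨ a = 1 ∧ b = 0 := by omega
    · obtain rfl := eq_of_pow_zero_ne_zero ha
      exact le_max_of_le_left (by rw [reach_eq_one hb, mul_one])
    · obtain rfl := eq_of_pow_zero_ne_zero hb
      exact le_max_of_le_right (by rw [reach_eq_one ha, mul_one])
  · by_cases h : pow A 1 i j = 0
    · simp [reach_eq_zero h]
    · rw [reach_eq_one h, mul_one, mul_one]
      exact max_le (WalkThrough.le_walkMeanPow ⟨0, 1, rfl, by simp [pow], h⟩)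
        (WalkThrough.le_walkMeanPow ⟨1, 0, rfl, h, by simp [pow]⟩)

end Criterion

/-! ### Programs with a cost bound and a frame -/

section Logic

/-- Contents of the real arrays of a store: name of the array, row, column. -/
abbrev RealArrays := ℕ → ℕ → ℕ → ℝ≥0

/-- The stores `s` and `s'` differ at most in the index registers in `R`, the real arrays in `D` and
the arrays of natural numbers. -/
structure Frame (R D : Finset ℕ) (s s' : Store) : Prop where
  reg_eq (x : ℕ) (hx : x ∉ R := by decide) : s'.reg x = s.reg x
  real_eq (a : ℕ) (ha : a ∉ D := by decide) : s'.real a = s.real a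

variable {R D R' D' : Finset ℕ} {s s' s'' : Store}

theorem Frame.refl (R D : Finset ℕ) (s : Store) : Frame R D s s :=
  ⟨fun _ _ => rfl, fun _ _ => rfl⟩

theorem Frame.trans (h : Frame R D s s') (h' : Frame R D s' s'') : Frame R D s s'' :=
  ⟨fun x hx => (h'.reg_eq x hx).trans (h.reg_eq x hx),
    fun a ha => (h'.real_eq a ha).trans (h.real_eq a ha)⟩

theorem Frame.mono (h : Frame R D s s') (hR : R ⊆ R') (hD : D ⊆ D') : Frame R' D' s s' :=
  ⟨fun x hx => h.reg_eq x fun hx' => hx (hR hx'), fun a ha => h.real_eq a fun ha' => ha (hD ha')⟩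

theorem Frame.setReg (h : Frame R D s s') {x : ℕ} (hx : x ∈ R) (v : ℕ) :
    Frame R D s (s'.setReg x v) :=
  ⟨fun z hz => (if_neg (ne_of_mem_of_not_mem hx hz).symm).trans (h.reg_eq z hz),
    fun a ha => h.real_eq a ha⟩

/-- Started in `s`, the program `P` stops after at most `k` operations, changes only index registers
in `R` and real arrays in `D`, and leaves real arrays that satisfy `Q`. -/
def Run (R D : Finset ℕ) (P : Prog) (k : ℕ) (s : Store) (Q : RealArrays → Prop) : Prop :=
  ∃ t s', Exec P s t s' ∧ t ≤ k ∧ Frame R D s s' ∧ Q s'.real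

variable {P P' : Prog} {k k' : ℕ} {Q Q' : RealArrays → Prop}

theorem Run.imp (h : Run R D P k s Q) (hQ : ∀ s', Frame R D s s' → Q s'.real → Q' s'.real) :
    Run R D P k s Q' :=
  let ⟨t, s', he, ht, hf, hq⟩ := h
  ⟨t, s', he, ht, hf, hQ s' hf hq⟩

theorem Run.weaken (h : Run R D P k s Q) (hk : k ≤ k') (hR : R ⊆ R' := by decide)
    (hD : D ⊆ D' := by decide) : Run R' D' P k' s Q :=
  let ⟨t, s', he, ht, hf, hq⟩ := h
  ⟨t, s', he, ht.trans hk, hf.mono hR hD, hq⟩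

theorem Run.seq (h : Run R D P k s Q)
    (h' : ∀ s', Frame R D s s' → Q s'.real → Run R' D' P' k' s' Q') :
    Run (R ∪ R') (D ∪ D') (.seq P P') (k + k') s Q' := by
  obtain ⟨t, s', he, ht, hf, hq⟩ := h
  obtain ⟨t', s'', he', ht', hf', hq'⟩ := h' s' hf hq
  exact ⟨t + t', s'', he.seq he', add_le_add ht ht',
    (hf.mono Finset.subset_union_left Finset.subset_union_left).trans
      (hf'.mono Finset.subset_union_right Finset.subset_union_right), hq'⟩

theorem Run.ite {b : Test} (h : b.Holds s → Run R D P k s Q)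
    (h' : ¬ b.Holds s → Run R D P' k s Q) : Run R D (.ite b P P') (1 + k) s Q := by
  by_cases hb : b.Holds s
  · obtain ⟨t, s', he, ht, hf, hq⟩ := h hb
    exact ⟨1 + t, s', .iteTrue hb he, by omega, hf, hq⟩
  · obtain ⟨t, s', he, ht, hf, hq⟩ := h' hb
    exact ⟨1 + t, s', .iteFalse hb he, by omega, hf, hq⟩

/-- `for i = 0, …, b - 1 do P`, where `i` and `b` are index registers. -/
def Prog.forLoop (i b : ℕ) (P : Prog) : Prog :=
  .seq (.op (.zero i)) (.while (.lt i b) (.seq P (.op (.succ i))))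

/-- Number of operations of a loop with `N` rounds of at most `k` operations each. -/
def forCost (N k : ℕ) : ℕ := N * (k + 2) + 2

theorem forCost_mono {N N' : ℕ} (hN : N ≤ N') (hk : k ≤ k') : forCost N k ≤ forCost N' k' := by
  unfold forCost; gcongr

section ForLoop

variable {i b N : ℕ}

theorem exists_exec_while (hN : s.reg b = N) (hi : i ∉ R) (hb : b ∉ insert i R)
    {I : ℕ → RealArrays → Prop}
    (hstep : ∀ x < N, ∀ s', Frame (insert i R) D s s' → s'.reg i = x → I x s'.real →
      Run R D P k s' (I (x + 1)))
    {r x : ℕ} (hx : x + r = N) (hf : Frame (insert i R) D s s') (hs' : s'.reg i = x)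
    (hI : I x s'.real) :
    ∃ t s'', Exec (.while (.lt i b) (.seq P (.op (.succ i)))) s' t s'' ∧ t ≤ r * (k + 2) + 1 ∧
      Frame (insert i R) D s s'' ∧ I N s''.real := by
  have htest : Test.Holds (.lt i b) s' ↔ x < N := by rw [Test.Holds, hs', hf.reg_eq b hb, hN]
  induction r generalizing x s' with
  | zero =>
    obtain rfl : x = N := hx
    exact ⟨1, s', .whileFalse (by simp [htest]), by omega, hf, hI⟩
  | succ r ih =>
    have hxN : x < N := by omega
    obtain ⟨t, s₁, he, ht, hf₁, hI₁⟩ := hstep x hxN s' hf hs' hI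
    have hf₂ := (hf.trans (hf₁.mono (Finset.subset_insert i R) subset_rfl)).setReg
      (Finset.mem_insert_self i R) (s₁.reg i + 1)
    have hi₂ : (s₁.setReg i (s₁.reg i + 1)).reg i = x + 1 := by
      simp [Store.setReg, hf₁.reg_eq i hi, hs']
    obtain ⟨u, s₂, he₂, hu, hf₃, hI₃⟩ := ih (by omega) hf₂ hi₂ hI₁
      (by rw [Test.Holds, hi₂, hf₂.reg_eq b hb, hN])
    exact ⟨1 + (t + 1) + u, s₂, .whileTrue (htest.2 hxN) (he.seq (.op (.succ i) s₁)) he₂,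
      by rw [Nat.succ_mul]; omega, hf₃, hI₃⟩

theorem Run.forLoop (hN : s.reg b = N) (hi : i ∉ R) (hb : b ∉ insert i R)
    (I : ℕ → RealArrays → Prop) (h0 : I 0 s.real)
    (hstep : ∀ x < N, ∀ s', Frame (insert i R) D s s' → s'.reg i = x → I x s'.real →
      Run R D P k s' (I (x + 1))) :
    Run (insert i R) D (.forLoop i b P) (forCost N k) s (I N) := by
  obtain ⟨t, s', he, ht, hf, hI⟩ := exists_exec_while (s' := s.setReg i 0) hN hi hb hstep
    (zero_add N) ((Frame.refl _ D s).setReg (Finset.mem_insert_self i R) 0) (if_pos rfl) h0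
  exact ⟨1 + t, s', .seq (.op (.zero i) s) he, by unfold forCost; omega, hf, hI⟩

theorem Run.forFin {n : ℕ} (hn : s.reg b = n) (hi : i ∉ R) (hb : b ∉ insert i R)
    (J : Finset (Fin n) → RealArrays → Prop) (h0 : J ∅ s.real)
    (hstep : ∀ S, ∀ x : Fin n, x ∉ S → ∀ s', Frame (insert i R) D s s' → s'.reg i = x →
      J S s'.real → Run R D P k s' (J (insert x S))) :
    Run (insert i R) D (.forLoop i b P) (forCost n k) s (J Finset.univ) := by
  have hn' : (Finset.univ.filter fun y : Fin n => y.val < n) = Finset.univ := by simp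
  rw [← hn']
  refine Run.forLoop hn hi hb (fun x => J (Finset.univ.filter fun y : Fin n => y.val < x))
    (by simpa using h0) fun x hx s' hf hs' hJ => ?_
  have hsucc : (Finset.univ.filter fun y : Fin n => y.val < x + 1) =
      insert ⟨x, hx⟩ (Finset.univ.filter fun y : Fin n => y.val < x) := by
    ext y
    simp only [Finset.mem_filter, Finset.mem_univ, true_and, Finset.mem_insert, Fin.ext_iff]
    omega
  rw [hsucc]
  exact hstep _ ⟨x, hx⟩ (by simp) s' hf hs' hJ

end ForLoop

/-- Two nested loops with the index registers `i` and `j` and the common bound `b`. -/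
def Prog.forPairs (i j b : ℕ) (P : Prog) : Prog := .forLoop i b (.forLoop j b P)

/-- Number of operations of two nested loops with `n` rounds each. -/
def pairsCost (n k : ℕ) : ℕ := forCost n (forCost n k)

theorem Run.forPairs {n i j b : ℕ} (hn : s.reg b = n) (hi : i ∉ insert j R) (hj : j ∉ R)
    (hb : b ∉ insert i (insert j R)) (J : Finset (Fin n × Fin n) → RealArrays → Prop)
    (h0 : J ∅ s.real)
    (hstep : ∀ Z, ∀ x y : Fin n, (x, y) ∉ Z → ∀ s', Frame (insert i (insert j R)) D s s' →
      s'.reg i = x → s'.reg j = y → J Z s'.real → Run R D P k s' (J (insert (x, y) Z))) :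
    Run (insert i (insert j R)) D (.forPairs i j b P) (pairsCost n k) s (J Finset.univ) := by
  rw [← Finset.univ_product_univ]
  refine Run.forFin hn hi hb (fun S => J (S ×ˢ Finset.univ)) h0 fun S x hx s₁ f₁ hi₁ h₁ => ?_
  rw [Finset.insert_eq x, Finset.union_product, Finset.union_comm]
  refine Run.forFin ((f₁.reg_eq b hb).trans hn) hj (fun h => hb (Finset.mem_insert_of_mem h))
    (fun S' => J (S ×ˢ Finset.univ ∪ {x} ×ˢ S')) (by simpa using h₁)
    fun S' y hy s₂ f₂ hj₂ h₂ => ?_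
  have hinsert : S ×ˢ Finset.univ ∪ {x} ×ˢ insert y S' =
      insert (x, y) (S ×ˢ Finset.univ ∪ {x} ×ˢ S') := by
    rw [Finset.insert_eq y, Finset.product_union, Finset.singleton_product_singleton,
      Finset.union_left_comm, Finset.insert_eq]
  rw [hinsert]
  exact hstep _ x y (by simp [hx, hy]) s₂ (f₁.trans (f₂.mono (Finset.subset_insert _ _) subset_rfl))
    ((f₂.reg_eq i hi).trans hi₁) hj₂ h₂

/-- The table `u` with its entry `x, y` replaced by `v`. -/
def setEntry (u : ℕ → ℕ → ℝ≥0) (x y : ℕ) (v : ℝ≥0) : ℕ → ℕ → ℝ≥0 :=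
  fun x' y' => if x' = x ∧ y' = y then v else u x' y'

theorem setEntry_self (u : ℕ → ℕ → ℝ≥0) (x y : ℕ) (v : ℝ≥0) : setEntry u x y v x y = v :=
  if_pos ⟨rfl, rfl⟩

theorem setEntry_of_ne (u : ℕ → ℕ → ℝ≥0) {x y x' y' : ℕ} (v : ℝ≥0) (h : ¬ (x' = x ∧ y' = y)) :
    setEntry u x y v x' y' = u x' y' :=
  if_neg h

theorem setEntry_eq_self (u : ℕ → ℕ → ℝ≥0) (x y : ℕ) : setEntry u x y (u x y) = u := by
  funext x' y'
  by_cases h : x' = x ∧ y' = y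
  · rw [h.1, h.2, setEntry_self]
  · exact setEntry_of_ne u _ h

theorem setEntry_setEntry (u : ℕ → ℕ → ℝ≥0) (x y : ℕ) (v w : ℝ≥0) :
    setEntry (setEntry u x y v) x y w = setEntry u x y w := by
  funext x' y'
  by_cases h : x' = x ∧ y' = y <;> simp [setEntry, h]

theorem Run.realOp {c : Instr} {a i j x y : ℕ} {v : ℝ≥0} (hc : c.apply s = s.setReal ⟨a, i, j⟩ v)
    (hi : s.reg i = x) (hj : s.reg j = y) :
    Run ∅ {a} (.op c) 1 s fun m => m a = setEntry (s.real a) x y v := by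
  subst hi hj
  refine ⟨1, _, .op c s, le_rfl, hc ▸ ⟨fun _ _ => rfl, fun b hb => ?_⟩, ?_⟩
  · funext x' y'
    exact if_neg fun h => hb (Finset.mem_singleton.2 h.1)
  · rw [hc]
    funext x' y'
    simp [Store.setReal, setEntry]

end Logic

/-! ### Matrix routines -/

/- `Reg.zero` holds `0` throughout: scalars are kept in the entry `0, 0` of an array and addressed
with it. -/

abbrev Reg.order : ℕ := 0
abbrev Reg.row : ℕ := 1
abbrev Reg.col : ℕ := 2
abbrev Reg.mid : ℕ := 3
abbrev Reg.round : ℕ := 4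
abbrev Reg.factor : ℕ := 5
abbrev Reg.repeat : ℕ := 6
abbrev Reg.zero : ℕ := 7

abbrev Arr.input : ℕ := 0
abbrev Arr.zero : ℕ := 1
abbrev Arr.tmp : ℕ := 2
abbrev Arr.base : ℕ := 3
abbrev Arr.power : ℕ := 4
abbrev Arr.powerNext : ℕ := 5
abbrev Arr.nodeMean : ℕ := 6
abbrev Arr.reachOne : ℕ := 7
abbrev Arr.meanOne : ℕ := 8
abbrev Arr.reach : ℕ := 9
abbrev Arr.mean : ℕ := 10
abbrev Arr.reachNext : ℕ := 11
abbrev Arr.meanNext : ℕ := 12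
abbrev Arr.first : ℕ := 13
abbrev Arr.flag : ℕ := 14
abbrev Arr.acc : ℕ := 15

/-- The reference to the scalar in the array `a`. -/
abbrev Ref.scalar (a : ℕ) : Ref := ⟨a, Reg.zero, Reg.zero⟩

/-- The constant cells of the store have their intended contents: the order `n` and two zeros. -/
structure Ready (n : ℕ) (s : Store) : Prop where
  order : s.reg Reg.order = n
  zero : s.reg Reg.zero = 0
  real_zero : s.real Arr.zero 0 0 = 0

/-- The leading `n × n` block of the array `a` is the matrix `M`. -/
def Holds {n : ℕ} (m : RealArrays) (a : ℕ) (M : Matrix (Fin n) (Fin n) ℝ≥0) : Prop :=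
  ∀ i j : Fin n, m a i j = M i j

section Routines

variable {n : ℕ} {s s' : Store} {R D : Finset ℕ}

theorem Ready.of_frame (h : Ready n s) (hf : Frame R D s s')
    (hR : Disjoint {Reg.order, Reg.zero} R := by decide) (hD : Arr.zero ∉ D := by decide) :
    Ready n s' := by
  simp only [Finset.disjoint_insert_left, Finset.disjoint_singleton_left] at hR
  exact ⟨(hf.reg_eq _ hR.1).trans h.order, (hf.reg_eq _ hR.2).trans h.zero,
    by rw [hf.real_eq _ hD, h.real_zero]⟩

theorem Holds.of_frame {a : ℕ} {M : Matrix (Fin n) (Fin n) ℝ≥0} (h : Holds s.real a M)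
    (hf : Frame R D s s') (ha : a ∉ D := by decide) : Holds s'.real a M := by
  rwa [Holds, hf.real_eq a ha]

/-- Execute `P` for all rows and columns. -/
abbrev Prog.forEntries (P : Prog) : Prog := .forPairs Reg.row Reg.col Reg.order P

theorem Run.fill {d k : ℕ} {P : Prog} (hs : s.reg Reg.order = n) (f : Matrix (Fin n) (Fin n) ℝ≥0)
    (hR : Disjoint {Reg.order, Reg.row, Reg.col} R)
    (hP : ∀ (i j : Fin n) s', Frame (insert Reg.row (insert Reg.col R)) D s s' →
      s'.reg Reg.row = i → s'.reg Reg.col = j → s'.real d i j = s.real d i j →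
      Run R D P k s' fun m => m d = setEntry (s'.real d) i j (f i j)) :
    Run (insert Reg.row (insert Reg.col R)) D P.forEntries (pairsCost n k) s
      fun m => Holds m d f := by
  simp only [Finset.disjoint_insert_left, Finset.disjoint_singleton_left] at hR
  obtain ⟨horder, hrow, hcol⟩ := hR
  refine (Run.forPairs hs (by simp [hrow]) hcol (by simp [horder])
    (fun Z m => ∀ i j : Fin n, m d i j = if (i, j) ∈ Z then f i j else s.real d i j)
    (by simp) fun Z x y hxy s' hf hx hy hZ => ?_).imp fun s' _ h i j => by simpa using h i j
  refine (hP x y s' hf hx hy (by simpa [hxy] using hZ x y)).imp fun s'' _ h i j => ?_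
  rw [h]
  by_cases hij : (i, j) = (x, y)
  · cases hij
    rw [setEntry_self, if_pos (Finset.mem_insert_self _ _)]
  · rw [setEntry_of_ne, hZ]
    · simp [Finset.mem_insert, hij]
    · simpa [Fin.ext_iff] using hij

/-- Set all entries of the array `d` to `0`. -/
def Prog.zeroMat (d : ℕ) : Prog := .forEntries (.op (.realZero ⟨d, Reg.row, Reg.col⟩))

theorem run_zeroMat (hs : Ready n s) (d : ℕ) :
    Run {Reg.row, Reg.col} {d} (.zeroMat d) (pairsCost n 1) s
      fun m => Holds m d (0 : Matrix (Fin n) (Fin n) ℝ≥0) :=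
  Run.fill (R := ∅) hs.order _ (by decide) fun _ _ _ _ hi hj _ => Run.realOp rfl hi hj

/-- Copy the array `a` to the array `d`. -/
def Prog.copyMat (d a : ℕ) : Prog :=
  .forEntries (.op (.realCopy ⟨d, Reg.row, Reg.col⟩ ⟨a, Reg.row, Reg.col⟩))

theorem run_copyMat (hs : Ready n s) {d a : ℕ} (had : a ≠ d) {M : Matrix (Fin n) (Fin n) ℝ≥0}
    (hM : Holds s.real a M) :
    Run {Reg.row, Reg.col} {d} (.copyMat d a) (pairsCost n 1) s fun m => Holds m d M :=
  Run.fill (R := ∅) hs.order _ (by decide) fun i j s' hf hi hj _ => by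
    refine Run.realOp ?_ hi hj
    simp only [Instr.apply, Store.getReal, hi, hj,
      hM.of_frame hf (Finset.notMem_singleton.2 had) i j]

/-- Replace the entry `row, col` of the array `d` by its maximum with the one of the product of the
arrays `a` and `b`. -/
def Prog.mulAccEntry (d a b : ℕ) : Prog :=
  .forLoop Reg.mid Reg.order <|
    .seq (.op (.realMul (.scalar Arr.tmp) ⟨a, Reg.row, Reg.mid⟩ ⟨b, Reg.mid, Reg.col⟩))
      (.op (.realMax ⟨d, Reg.row, Reg.col⟩ ⟨d, Reg.row, Reg.col⟩ (.scalar Arr.tmp)))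

section MulAcc

variable {d a b : ℕ} {M M' : Matrix (Fin n) (Fin n) ℝ≥0}

theorem run_mulAccEntry (hs : Ready n s) (hd : d ≠ Arr.tmp) (ha : a ∉ ({d, Arr.tmp} : Finset ℕ))
    (hb : b ∉ ({d, Arr.tmp} : Finset ℕ)) (hM : Holds s.real a M) (hM' : Holds s.real b M')
    {i j : Fin n} (hi : s.reg Reg.row = i) (hj : s.reg Reg.col = j) {c : ℝ≥0}
    (hc : s.real d i j = c) :
    Run {Reg.mid} {d, Arr.tmp} (.mulAccEntry d a b) (forCost n 2) s
      fun m => m d = setEntry (s.real d) i j (max c (mul M M' i j)) := by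
  refine Run.forFin (R := ∅) hs.order (by decide) (by decide)
    (fun S m => m d = setEntry (s.real d) i j (max c (S.sup fun k => M i k * M' k j)))
    (by simp [← hc, setEntry_eq_self]) fun S k _ s₁ f₁ hk h₁ => ?_
  have hi₁ := (f₁.reg_eq Reg.row).trans hi
  have hj₁ := (f₁.reg_eq Reg.col).trans hj
  have hz₁ := (f₁.reg_eq Reg.zero).trans hs.zero
  have hmul : Run ∅ {Arr.tmp}
      (.op (.realMul (.scalar Arr.tmp) ⟨a, Reg.row, Reg.mid⟩ ⟨b, Reg.mid, Reg.col⟩)) 1 s₁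
      fun m => m Arr.tmp = setEntry (s₁.real Arr.tmp) 0 0 (M i k * M' k j) :=
    Run.realOp (by simp only [Instr.apply, Store.getReal, hi₁, hj₁, hk, hM.of_frame f₁ ha i k,
      hM'.of_frame f₁ hb k j]) hz₁ hz₁
  refine (hmul.seq (R' := ∅) (D' := {d}) (k' := 1) fun s₂ f₂ h₂ => ?_).weaken le_rfl (by simp)
    (Finset.pair_comm d Arr.tmp).symm.subset
  have hd₂ : s₂.real d = s₁.real d := f₂.real_eq d (by simpa using hd)
  refine (Run.realOp (v := max c ((insert k S).sup fun k => M i k * M' k j)) ?_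
    ((f₂.reg_eq _).trans hi₁) ((f₂.reg_eq _).trans hj₁)).imp fun s₃ _ h₃ => ?_
  · simp only [Instr.apply, Store.getReal, f₂.reg_eq _ (Finset.notMem_empty _), hi₁, hj₁, hz₁, hd₂,
      h₁, h₂, setEntry_self, Finset.sup_insert]
    rw [max_assoc, max_comm (S.sup _)]
  · rw [h₃, hd₂, h₁, setEntry_setEntry]

/-- Replace the array `d` by its maximum with the product of the arrays `a` and `b`. -/
def Prog.mulAcc (d a b : ℕ) : Prog := .forEntries (.mulAccEntry d a b)

theorem run_mulAcc (hs : Ready n s) (hM : Holds s.real a M) (hM' : Holds s.real b M')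
    {C : Matrix (Fin n) (Fin n) ℝ≥0} (hC : Holds s.real d C)
    (hd : d ∉ ({Arr.zero, Arr.tmp} : Finset ℕ) := by decide)
    (ha : a ∉ ({d, Arr.tmp} : Finset ℕ) := by decide)
    (hb : b ∉ ({d, Arr.tmp} : Finset ℕ) := by decide) :
    Run {Reg.row, Reg.col, Reg.mid} {d, Arr.tmp} (.mulAcc d a b) (pairsCost n (forCost n 2)) s
      fun m => Holds m d fun i j => max (C i j) (mul M M' i j) := by
  simp only [Finset.mem_insert, Finset.mem_singleton, not_or] at hd
  exact Run.fill (R := {Reg.mid}) hs.order _ (by decide) fun i j s' hf hi hj hij =>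
    run_mulAccEntry (hs.of_frame hf (by decide) (by simpa [eq_comm] using hd.1)) hd.2 ha hb
      (hM.of_frame hf ha) (hM'.of_frame hf hb) hi hj (hij.trans (hC i j))

/-- Set the array `d` to the product of the arrays `a` and `b`. -/
def Prog.matMul (d a b : ℕ) : Prog := .seq (.zeroMat d) (.mulAcc d a b)

theorem run_matMul (hs : Ready n s) (hM : Holds s.real a M) (hM' : Holds s.real b M')
    (hd : d ∉ ({Arr.zero, Arr.tmp} : Finset ℕ) := by decide)
    (ha : a ∉ ({d, Arr.tmp} : Finset ℕ) := by decide)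
    (hb : b ∉ ({d, Arr.tmp} : Finset ℕ) := by decide) :
    Run {Reg.row, Reg.col, Reg.mid} {d, Arr.tmp} (.matMul d a b)
      (pairsCost n 1 + pairsCost n (forCost n 2)) s fun m => Holds m d (mul M M') := by
  have hsub : ({d} : Finset ℕ) ⊆ {d, Arr.tmp} := by simp
  have hzero : Arr.zero ∉ ({d} : Finset ℕ) := fun h => hd (by simp [← Finset.mem_singleton.1 h])
  refine ((run_zeroMat hs d).seq fun s' hf h0 =>
    (run_mulAcc (hs.of_frame hf (by decide) hzero) (hM.of_frame hf fun h => ha (hsub h))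
      (hM'.of_frame hf fun h => hb (hsub h)) h0 hd ha hb).imp fun s'' _ h => ?_).weaken le_rfl
    (by decide) (by simp)
  simpa only [Matrix.zero_apply, zero_le, max_eq_right] using h

end MulAcc

end Routines

/-! ### Phases of the decision procedure -/

section Phases

variable {n : ℕ} {A : Matrix (Fin n) (Fin n) ℝ≥0} {s : Store}

/-- The arrays `a` and `b` describe the walks of length `t`: they hold `reach A t` and
`walkMeanPow A t`. -/
def HoldsWalks (A : Matrix (Fin n) (Fin n) ℝ≥0) (t : ℕ) (m : RealArrays) (a b : ℕ) : Prop :=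
  Holds m a (reach A t) ∧ Holds m b (walkMeanPow A t)

theorem HoldsWalks.of_frame {R D : Finset ℕ} {s' : Store} {t a b : ℕ}
    (h : HoldsWalks A t s.real a b) (hf : Frame R D s s') (ha : a ∉ D := by decide)
    (hb : b ∉ D := by decide) : HoldsWalks A t s'.real a b :=
  ⟨h.1.of_frame hf ha, h.2.of_frame hf hb⟩

/-- Extend the walks described by `Arr.reach` and `Arr.mean` by those described by the arrays `u`
and `w`. -/
def Prog.extendWalks (u w : ℕ) : Prog :=
  .seq (.matMul Arr.reachNext Arr.reach u) <|
  .seq (.seq (.matMul Arr.meanNext Arr.mean u) (.mulAcc Arr.meanNext Arr.reach w)) <|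
  .seq (.copyMat Arr.reach Arr.reachNext) (.copyMat Arr.mean Arr.meanNext)

/-- Number of operations of a product of matrices that is added to a given matrix. -/
abbrev mulAccCost (n : ℕ) : ℕ := pairsCost n (forCost n 2)

/-- Number of operations of `Prog.matMul`. -/
abbrev matMulCost (n : ℕ) : ℕ := pairsCost n 1 + mulAccCost n

/-- Number of operations of `Prog.extendWalks`. -/
abbrev extendWalksCost (n : ℕ) : ℕ :=
  matMulCost n + (matMulCost n + mulAccCost n + (pairsCost n 1 + pairsCost n 1))

theorem run_meanNext (hs : Ready n s) {x y u w : ℕ}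
    (hx : HoldsWalks A x s.real Arr.reach Arr.mean) (hy : HoldsWalks A y s.real u w)
    (hu : u ∉ ({Arr.tmp, Arr.reachNext, Arr.meanNext} : Finset ℕ))
    (hw : w ∉ ({Arr.tmp, Arr.reachNext, Arr.meanNext} : Finset ℕ)) :
    Run {Reg.row, Reg.col, Reg.mid} {Arr.meanNext, Arr.tmp}
      (.seq (.matMul Arr.meanNext Arr.mean u) (.mulAcc Arr.meanNext Arr.reach w))
      (matMulCost n + mulAccCost n) s fun m => Holds m Arr.meanNext (walkMeanPow A (x + y)) := by
  have hu' : u ∉ ({Arr.meanNext, Arr.tmp} : Finset ℕ) := by simp_all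
  have hw' : w ∉ ({Arr.meanNext, Arr.tmp} : Finset ℕ) := by simp_all
  refine ((run_matMul hs hx.2 hy.1 (hb := hu')).seq fun s₁ f₁ h₁ =>
    (run_mulAcc (hs.of_frame f₁) (hx.1.of_frame f₁) (hy.2.of_frame f₁ hw') h₁ (hb := hw')).imp
    fun s₂ _ h₂ i j => ?_).weaken le_rfl
  rw [h₂, walkMeanPow_add]

theorem run_extendWalks (hs : Ready n s) {x y u w : ℕ}
    (hx : HoldsWalks A x s.real Arr.reach Arr.mean) (hy : HoldsWalks A y s.real u w)
    (hu : u ∉ ({Arr.tmp, Arr.reachNext, Arr.meanNext} : Finset ℕ) := by decide)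
    (hw : w ∉ ({Arr.tmp, Arr.reachNext, Arr.meanNext} : Finset ℕ) := by decide) :
    Run {Reg.row, Reg.col, Reg.mid} {Arr.reach, Arr.mean, Arr.reachNext, Arr.meanNext, Arr.tmp}
      (.extendWalks u w) (extendWalksCost n) s
      fun m => HoldsWalks A (x + y) m Arr.reach Arr.mean := by
  have hu' : u ∉ ({Arr.reachNext, Arr.tmp} : Finset ℕ) := by simp_all
  have hw' : w ∉ ({Arr.reachNext, Arr.tmp} : Finset ℕ) := by simp_all
  refine ((run_matMul hs hx.1 hy.1 (hb := hu')).seq fun s₁ f₁ h₁ =>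
    (run_meanNext (hs.of_frame f₁) (hx.of_frame f₁) (hy.of_frame f₁ hu' hw') hu hw).seq
    fun s₂ f₂ h₂ => (run_copyMat ((hs.of_frame f₁).of_frame f₂) (by decide)
      (h₁.of_frame f₂)).seq fun s₃ f₃ h₃ =>
    (run_copyMat (((hs.of_frame f₁).of_frame f₂).of_frame f₃) (by decide) (h₂.of_frame f₃)).imp
    fun s₄ f₄ h₄ => ⟨?_, h₄⟩).weaken le_rfl
  rw [reach_add]
  exact h₃.of_frame f₄

/-- Extend the walks described by `Arr.reach` and `Arr.mean`, one after another, to eight times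
their length, as many times as the order says. -/
def Prog.squarePhase : Prog :=
  .forLoop Reg.round Reg.order <|
    .seq (.extendWalks Arr.reach Arr.mean) <|
    .seq (.extendWalks Arr.reach Arr.mean) (.extendWalks Arr.reach Arr.mean)

/-- Number of operations of `Prog.squarePhase`. -/
abbrev squareCost (n : ℕ) : ℕ :=
  forCost n (extendWalksCost n + (extendWalksCost n + extendWalksCost n))

theorem run_squarePhase (hs : Ready n s) (h : HoldsWalks A 1 s.real Arr.reach Arr.mean) :
    Run {Reg.row, Reg.col, Reg.mid, Reg.round}
      {Arr.reach, Arr.mean, Arr.reachNext, Arr.meanNext, Arr.tmp} .squarePhase (squareCost n) s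
      fun m => HoldsWalks A (8 ^ n) m Arr.reach Arr.mean := by
  refine (Run.forLoop (R := {Reg.row, Reg.col, Reg.mid})
    (D := {Arr.reach, Arr.mean, Arr.reachNext, Arr.meanNext, Arr.tmp}) hs.order (by decide)
    (by decide) (fun x m => HoldsWalks A (8 ^ x) m Arr.reach Arr.mean) h fun x _ s₁ f₁ _ h₁ =>
      ?_).weaken le_rfl
  have hs₁ := hs.of_frame f₁
  refine ((run_extendWalks hs₁ h₁ h₁).seq fun s₂ f₂ h₂ =>
    (run_extendWalks (hs₁.of_frame f₂) h₂ h₂).seq fun s₃ f₃ h₃ =>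
    (run_extendWalks ((hs₁.of_frame f₂).of_frame f₃) h₃ h₃).imp fun s₄ _ h₄ => ?_).weaken le_rfl
  rw [pow_succ, show 8 ^ x * 8 = 8 ^ x + 8 ^ x + (8 ^ x + 8 ^ x) +
    (8 ^ x + 8 ^ x + (8 ^ x + 8 ^ x)) by ring]
  exact h₄

end Phases

section NodeMeans

variable {n : ℕ} {A : Matrix (Fin n) (Fin n) ℝ≥0} {s : Store}

/-- The operation without effect. -/
abbrev Prog.skip : Prog := .op (.copy Reg.zero Reg.zero)

theorem run_skip {Q : RealArrays → Prop} {R D : Finset ℕ} {k : ℕ} (hk : 1 ≤ k) (h : Q s.real) :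
    Run R D .skip k s Q := by
  refine ⟨1, _, .op _ s, hk, ⟨fun x _ => ?_, fun _ _ => rfl⟩, h⟩
  simp only [Instr.apply, Store.setReg, ite_eq_right_iff]
  exact fun hx => hx ▸ rfl

theorem run_scalarOp (hz : s.reg Reg.zero = 0) {c : Instr} {a : ℕ} {v : ℝ≥0}
    (hc : c.apply s = s.setReal (.scalar a) v) :
    Run ∅ {a} (.op c) 1 s fun m => m a 0 0 = v :=
  (Run.realOp hc hz hz).imp fun s' _ h => by rw [h, setEntry_self]

/-- Raise the scalar in `Arr.acc` to the power with exponent `Reg.factor` plus one. -/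
def Prog.raiseAcc : Prog :=
  .seq (.op (.realCopy (.scalar Arr.base) (.scalar Arr.acc))) <|
  .forLoop Reg.repeat Reg.factor <|
    .op (.realMul (.scalar Arr.acc) (.scalar Arr.acc) (.scalar Arr.base))

/-- Number of operations of `Prog.raiseAcc`. -/
abbrev raiseCost (n : ℕ) : ℕ := 1 + forCost n 1

theorem run_raiseAcc (hz : s.reg Reg.zero = 0) {y : ℕ} (hy : s.reg Reg.factor = y) {q : ℝ≥0}
    (hq : s.real Arr.acc 0 0 = q) :
    Run {Reg.repeat} {Arr.acc, Arr.base} .raiseAcc (raiseCost y) s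
      fun m => m Arr.acc 0 0 = q ^ (y + 1) := by
  refine ((run_scalarOp (a := Arr.base) hz (v := q)
    (by simp only [Instr.apply, Store.getReal, hz, hq])).seq
    fun s₁ f₁ h₁ => ((Run.forLoop (R := ∅) (D := {Arr.acc}) ((f₁.reg_eq _).trans hy) (by decide)
      (by decide) (fun x m => m Arr.acc 0 0 = q ^ (x + 1)) ?_ fun x _ s₂ f₂ _ h₂ =>
      ?_))).weaken le_rfl
  · rw [f₁.real_eq Arr.acc, hq, zero_add, pow_one]
  · have hz₂ : s₂.reg Reg.zero = 0 := ((f₂.reg_eq _).trans (f₁.reg_eq _)).trans hz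
    refine run_scalarOp hz₂ ?_
    simp only [Instr.apply, Store.getReal, hz₂, h₂, f₂.real_eq Arr.base, h₁, pow_succ _ (x + 1)]

/-- Raise the scalar in `Arr.acc` to the power with exponent `n! / (k + 1)`, where `k` is the
content of `Reg.round`. -/
def Prog.raiseAccFactorial : Prog :=
  .forLoop Reg.factor Reg.order <| .ite (.eq Reg.factor Reg.round) .skip .raiseAcc

/-- Number of operations of `Prog.raiseAccFactorial`. -/
abbrev raiseFactorialCost (n : ℕ) : ℕ := forCost n (1 + raiseCost n)

theorem run_raiseAccFactorial (hs : Ready n s) {k : ℕ} (hk : s.reg Reg.round = k) {q : ℝ≥0}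
    (hq : s.real Arr.acc 0 0 = q) :
    Run {Reg.factor, Reg.repeat} {Arr.acc, Arr.base} .raiseAccFactorial (raiseFactorialCost n) s
      fun m => m Arr.acc 0 0 = q ^ ∏ l ∈ (Finset.range n).erase k, (l + 1) := by
  refine Run.forLoop (R := {Reg.repeat}) hs.order (by decide) (by decide)
    (fun x m => m Arr.acc 0 0 = q ^ ∏ l ∈ (Finset.range x).erase k, (l + 1)) (by simpa using hq)
    fun x hx s₁ f₁ hx₁ h₁ => ?_
  have htest : Test.Holds (.eq Reg.factor Reg.round) s₁ ↔ x = k := by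
    rw [Test.Holds, hx₁, f₁.reg_eq Reg.round, hk]
  refine Run.ite (fun h => run_skip (Nat.le_add_right _ _) ?_) fun h =>
    ((run_raiseAcc ((f₁.reg_eq _).trans hs.zero) hx₁ h₁).imp fun s₂ _ h₂ => ?_).weaken
      (Nat.add_le_add_left (forCost_mono hx.le le_rfl) 1)
  · rw [htest.1 h, Finset.range_add_one, Finset.erase_insert Finset.notMem_range_self]
    rwa [htest.1 h, Finset.erase_eq_of_notMem Finset.notMem_range_self] at h₁
  · rw [h₂, Finset.range_add_one, Finset.erase_insert_of_ne (htest.not.1 h), Finset.prod_insert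
      (by simp), ← pow_mul, mul_comm]

/-- The first `n` entries of the first column of the array `a` are those of the vector `f`. -/
def HoldsVec (m : RealArrays) (a : ℕ) (f : Fin n → ℝ≥0) : Prop := ∀ i : Fin n, m a i 0 = f i

theorem HoldsVec.of_frame {R D : Finset ℕ} {s' : Store} {a : ℕ} {f : Fin n → ℝ≥0}
    (h : HoldsVec s.real a f) (hf : Frame R D s s') (ha : a ∉ D := by decide) :
    HoldsVec s'.real a f := by
  rwa [HoldsVec, hf.real_eq a ha]

/-- Replace the entry `row` of `Arr.nodeMean` by its maximum with the power of the diagonal entry of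
`Arr.power` whose exponent is computed by `Prog.raiseAccFactorial`. -/
def Prog.updateNodeMean : Prog :=
  .seq (.op (.realCopy (.scalar Arr.acc) ⟨Arr.power, Reg.row, Reg.row⟩)) <|
  .seq .raiseAccFactorial <|
  .op (.realMax ⟨Arr.nodeMean, Reg.row, Reg.zero⟩ ⟨Arr.nodeMean, Reg.row, Reg.zero⟩
    (.scalar Arr.acc))

/-- Number of operations of `Prog.updateNodeMean`. -/
abbrev updateNodeMeanCost (n : ℕ) : ℕ := 1 + (raiseFactorialCost n + 1)

theorem run_updateNodeMean (hs : Ready n s) {k : ℕ} (hk : s.reg Reg.round = k)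
    {P : Matrix (Fin n) (Fin n) ℝ≥0} (hP : Holds s.real Arr.power P) {L : Fin n → ℝ≥0} {i : Fin n}
    (hi : s.reg Reg.row = i) (hL : s.real Arr.nodeMean i 0 = L i) :
    Run {Reg.factor, Reg.repeat} {Arr.nodeMean, Arr.acc, Arr.base} .updateNodeMean
      (updateNodeMeanCost n) s fun m => m Arr.nodeMean = setEntry (s.real Arr.nodeMean) i 0
        (max (L i) (P i i ^ ∏ l ∈ (Finset.range n).erase k, (l + 1))) := by
  refine ((run_scalarOp (a := Arr.acc) hs.zero (v := P i i)
    (by simp only [Instr.apply, Store.getReal, hi, hP i i])).seq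
    fun s₁ f₁ h₁ => (run_raiseAccFactorial (hs.of_frame f₁)
    ((f₁.reg_eq _).trans hk) h₁).seq (R' := ∅) (D' := {Arr.nodeMean}) (k' := 1)
    fun s₂ f₂ h₂ => ?_).weaken le_rfl
  have f₁₂ := (f₁.mono (Finset.empty_subset _) (by decide)).trans f₂
  have hi₂ := (f₁₂.reg_eq Reg.row).trans hi
  have hz₂ := (f₁₂.reg_eq Reg.zero).trans hs.zero
  rw [← f₁₂.real_eq Arr.nodeMean]
  refine Run.realOp ?_ hi₂ hz₂
  simp only [Instr.apply, Store.getReal, hi₂, hz₂, h₂, f₁₂.real_eq Arr.nodeMean, hL]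

end NodeMeans

section Initialization

variable {n : ℕ} {A : Matrix (Fin n) (Fin n) ℝ≥0} {s : Store}

/-- Execute `Prog.updateNodeMean` for all rows. -/
def Prog.updateNodeMeans : Prog := .forLoop Reg.row Reg.order .updateNodeMean

/-- Number of operations of `Prog.updateNodeMeans`. -/
abbrev updateNodeMeansCost (n : ℕ) : ℕ := forCost n (updateNodeMeanCost n)

theorem run_updateNodeMeans (hs : Ready n s) {k : ℕ} (hk : s.reg Reg.round = k)
    {P : Matrix (Fin n) (Fin n) ℝ≥0} (hP : Holds s.real Arr.power P) {L : Fin n → ℝ≥0}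
    (hL : HoldsVec s.real Arr.nodeMean L) :
    Run {Reg.row, Reg.factor, Reg.repeat} {Arr.nodeMean, Arr.acc, Arr.base} .updateNodeMeans
      (updateNodeMeansCost n) s fun m => HoldsVec m Arr.nodeMean
        fun i => max (L i) (P i i ^ ∏ l ∈ (Finset.range n).erase k, (l + 1)) := by
  refine (Run.forFin (R := {Reg.factor, Reg.repeat}) (D := {Arr.nodeMean, Arr.acc, Arr.base})
    hs.order (by decide) (by decide) (fun S m => HoldsVec m Arr.nodeMean fun i =>
      if i ∈ S then max (L i) (P i i ^ ∏ l ∈ (Finset.range n).erase k, (l + 1)) else L i)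
    (by simpa using hL) fun S x hx s₁ f₁ hx₁ h₁ =>
      (run_updateNodeMean (L := L) (hs.of_frame f₁) ((f₁.reg_eq _).trans hk) (hP.of_frame f₁) hx₁
        ((h₁ x).trans (if_neg hx))).imp fun s₂ _ h₂ i => ?_).imp fun s' _ h => by simpa using h
  rw [h₂]
  by_cases hi : i = x
  · rw [hi, setEntry_self]
    exact (if_pos (Finset.mem_insert_self x S)).symm
  · rw [setEntry_of_ne _ _ (by simpa [Fin.ext_iff] using hi), h₁]
    simp only [Finset.mem_insert, hi, false_or]

/-- Set `Arr.power` to the identity matrix. -/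
def Prog.powerOne : Prog :=
  .forEntries <| .ite (.eq Reg.row Reg.col) (.op (.realOne ⟨Arr.power, Reg.row, Reg.col⟩))
    (.op (.realZero ⟨Arr.power, Reg.row, Reg.col⟩))

theorem run_powerOne (hs : Ready n s) :
    Run {Reg.row, Reg.col} {Arr.power} .powerOne (pairsCost n 2) s
      fun m => Holds m Arr.power (1 : Matrix (Fin n) (Fin n) ℝ≥0) := by
  refine Run.fill (R := ∅) hs.order _ (by decide) fun i j s₁ _ hi hj _ => ?_
  have htest : Test.Holds (.eq Reg.row Reg.col) s₁ ↔ i = j := by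
    rw [Test.Holds, hi, hj, Fin.ext_iff]
  refine Run.ite (k := 1) (fun h => ?_) fun h => ?_
  · rw [htest.1 h, Matrix.one_apply_eq]
    exact Run.realOp rfl (hi.trans (congrArg _ (htest.1 h))) hj
  · rw [Matrix.one_apply_ne (htest.not.1 h)]
    exact Run.realOp rfl hi hj

/-- Compute `nodeMeanPow` from the diagonals of the powers of the input. -/
def Prog.nodeMeanPhase : Prog :=
  .seq .powerOne <| .forLoop Reg.round Reg.order <|
    .seq (.matMul Arr.powerNext Arr.power Arr.input) <|
    .seq (.copyMat Arr.power Arr.powerNext) .updateNodeMeans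

/-- Number of operations of `Prog.nodeMeanPhase`. -/
abbrev nodeMeanCost (n : ℕ) : ℕ :=
  pairsCost n 2 + forCost n (matMulCost n + (pairsCost n 1 + updateNodeMeansCost n))

theorem run_nodeMeanPhase (hs : Ready n s) (hA : Holds s.real Arr.input A)
    (h0 : HoldsVec s.real Arr.nodeMean (0 : Fin n → ℝ≥0)) :
    Run {Reg.row, Reg.col, Reg.mid, Reg.round, Reg.factor, Reg.repeat}
      {Arr.power, Arr.powerNext, Arr.nodeMean, Arr.acc, Arr.base, Arr.tmp} .nodeMeanPhase
      (nodeMeanCost n) s fun m => HoldsVec m Arr.nodeMean (nodeMeanPow A) := by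
  refine ((run_powerOne hs).seq fun s₁ f₁ h₁ => (Run.forLoop
    (R := {Reg.row, Reg.col, Reg.mid, Reg.factor, Reg.repeat})
    (D := {Arr.power, Arr.powerNext, Arr.nodeMean, Arr.acc, Arr.base, Arr.tmp})
    (hs.of_frame f₁).order (by decide) (by decide)
    (fun x m => Holds m Arr.power (pow A x) ∧ HoldsVec m Arr.nodeMean fun v =>
      (Finset.range x).sup fun k => pow A (k + 1) v v ^ ∏ l ∈ (Finset.range n).erase k, (l + 1))
    ⟨h₁, by simpa [HoldsVec] using h0.of_frame f₁⟩ fun x _ s₂ f₂ hx₂ h₂ => ?_).imp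
    fun s' _ h => h.2).weaken le_rfl
  have hs₂ := (hs.of_frame f₁).of_frame f₂
  refine ((run_matMul hs₂ h₂.1 ((hA.of_frame f₁).of_frame f₂)).seq fun s₃ f₃ h₃ =>
    (run_copyMat (hs₂.of_frame f₃) (by decide) h₃).seq fun s₄ f₄ h₄ =>
    (run_updateNodeMeans ((hs₂.of_frame f₃).of_frame f₄)
      (((f₄.reg_eq _).trans (f₃.reg_eq _)).trans hx₂) h₄
      ((h₂.2.of_frame f₃).of_frame f₄)).imp fun s₅ f₅ h₅ => ⟨h₄.of_frame f₅, ?_⟩).weaken le_rfl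
  intro v
  refine (h₅ v).trans ?_
  simp only [Finset.range_add_one, Finset.sup_insert]
  exact max_comm _ _

/-- Compute `reach A 1` in `Arr.reachOne`. -/
def Prog.setReachOne : Prog :=
  .forEntries <| .ite (.realLe ⟨Arr.input, Reg.row, Reg.col⟩ (.scalar Arr.zero))
    (.op (.realZero ⟨Arr.reachOne, Reg.row, Reg.col⟩))
    (.op (.realOne ⟨Arr.reachOne, Reg.row, Reg.col⟩))

theorem run_setReachOne (hs : Ready n s) (hA : Holds s.real Arr.input A) :
    Run {Reg.row, Reg.col} {Arr.reachOne} .setReachOne (pairsCost n 2) s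
      fun m => Holds m Arr.reachOne (reach A 1) := by
  refine Run.fill (R := ∅) hs.order _ (by decide) fun i j s₁ f₁ hi hj _ => ?_
  have hs₁ := hs.of_frame f₁
  have htest : Test.Holds (.realLe ⟨Arr.input, Reg.row, Reg.col⟩ (.scalar Arr.zero)) s₁ ↔
      A i j ≤ 0 := by
    simp only [Test.Holds, Store.getReal, hi, hj, hs₁.zero, hs₁.real_zero,
      hA.of_frame f₁ (by decide) i j]
  refine Run.ite (k := 1) (fun h => ?_) fun h => ?_
  · rw [reach_one, if_pos (htest.1 h)]
    exact Run.realOp rfl hi hj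
  · rw [reach_one, if_neg (htest.not.1 h)]
    exact Run.realOp rfl hi hj

/-- Compute `walkMeanPow A 1` in `Arr.meanOne`. -/
def Prog.setMeanOne : Prog :=
  .forEntries <|
    .seq (.op (.realMax (.scalar Arr.tmp) ⟨Arr.nodeMean, Reg.row, Reg.zero⟩
      ⟨Arr.nodeMean, Reg.col, Reg.zero⟩))
    (.op (.realMul ⟨Arr.meanOne, Reg.row, Reg.col⟩ (.scalar Arr.tmp)
      ⟨Arr.reachOne, Reg.row, Reg.col⟩))

theorem run_setMeanOne (hs : Ready n s) (hreach : Holds s.real Arr.reachOne (reach A 1))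
    (hmean : HoldsVec s.real Arr.nodeMean (nodeMeanPow A)) :
    Run {Reg.row, Reg.col} {Arr.meanOne, Arr.tmp} .setMeanOne (pairsCost n 2) s
      fun m => Holds m Arr.meanOne (walkMeanPow A 1) := by
  refine Run.fill (R := ∅) hs.order _ (by decide) fun i j s₁ f₁ hi hj _ => ?_
  have hz := (hs.of_frame f₁).zero
  have hmean₁ : HoldsVec s₁.real Arr.nodeMean (nodeMeanPow A) := hmean.of_frame f₁
  refine ((run_scalarOp (a := Arr.tmp) hz (v := max (nodeMeanPow A i) (nodeMeanPow A j)) (by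
    simp only [Instr.apply, Store.getReal, hi, hj, hz, hmean₁ i, hmean₁ j])).seq (R' := ∅)
    (D' := {Arr.meanOne}) (k' := 1) fun s₂ f₂ h₂ => ?_).weaken le_rfl
  rw [← f₂.real_eq Arr.meanOne, walkMeanPow_one, ← max_mul]
  have hi₂ := (f₂.reg_eq Reg.row).trans hi
  have hj₂ := (f₂.reg_eq Reg.col).trans hj
  refine Run.realOp ?_ hi₂ hj₂
  simp only [Instr.apply, Store.getReal, hi₂, hj₂, (f₂.reg_eq Reg.zero).trans hz, h₂,
    (hreach.of_frame f₁).of_frame f₂ (by decide) i j]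

/-- Compute the description of the walks of length `1`, in two copies. -/
def Prog.walksOne : Prog :=
  .seq .setReachOne <| .seq .setMeanOne <|
  .seq (.copyMat Arr.reach Arr.reachOne) (.copyMat Arr.mean Arr.meanOne)

/-- Number of operations of `Prog.walksOne`. -/
abbrev walksOneCost (n : ℕ) : ℕ :=
  pairsCost n 2 + (pairsCost n 2 + (pairsCost n 1 + pairsCost n 1))

theorem run_walksOne (hs : Ready n s) (hA : Holds s.real Arr.input A)
    (hmean : HoldsVec s.real Arr.nodeMean (nodeMeanPow A)) :
    Run {Reg.row, Reg.col} {Arr.reachOne, Arr.meanOne, Arr.reach, Arr.mean, Arr.tmp} .walksOne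
      (walksOneCost n) s
      fun m => HoldsWalks A 1 m Arr.reachOne Arr.meanOne ∧ HoldsWalks A 1 m Arr.reach Arr.mean := by
  refine ((run_setReachOne hs hA).seq fun s₁ f₁ h₁ =>
    (run_setMeanOne (hs.of_frame f₁) h₁ (hmean.of_frame f₁)).seq
    fun s₂ f₂ h₂ => (run_copyMat ((hs.of_frame f₁).of_frame f₂) (by decide)
      (h₁.of_frame f₂)).seq fun s₃ f₃ h₃ =>
    (run_copyMat (((hs.of_frame f₁).of_frame f₂).of_frame f₃) (by decide) (h₂.of_frame f₃)).imp
    fun s₄ f₄ h₄ => ⟨⟨((h₁.of_frame f₂).of_frame f₃).of_frame f₄,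
      (h₂.of_frame f₃).of_frame f₄⟩, h₃.of_frame f₄, h₄⟩).weaken le_rfl

end Initialization

section Check

variable {n : ℕ} {A : Matrix (Fin n) (Fin n) ℝ≥0} {s : Store}

/-- Record of the values `x` seen for pairs `j, k` of columns, where `V` is the set of the triples
`(j, k, x)`: `Arr.first` holds a nonzero value for each pair for which there is one, and the scalar
in `Arr.flag` is nonzero as long as no pair has two distinct nonzero values. -/
structure Tally (V : Set (Fin n × Fin n × ℝ≥0)) (m : RealArrays) : Prop where
  eq_zero ⦃j k : Fin n⦄ ⦃x : ℝ≥0⦄ : m Arr.first j k = 0 → (j, k, x) ∈ V → x = 0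
  mem ⦃j k : Fin n⦄ : m Arr.first j k ≠ 0 → (j, k, m Arr.first j k) ∈ V
  flag : m Arr.flag 0 0 ≠ 0 ↔ ∀ ⦃j k : Fin n⦄ ⦃x⦄, (j, k, x) ∈ V → x ≠ 0 → x = m Arr.first j k

namespace Tally

variable {V : Set (Fin n × Fin n × ℝ≥0)} {m m' : RealArrays} {j k : Fin n} {x : ℝ≥0}

theorem congr (h : Tally V m) (hfirst : m' Arr.first = m Arr.first)
    (hflag : m' Arr.flag = m Arr.flag) : Tally V m' := by
  constructor
  · rw [hfirst]; exact h.eq_zero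
  · rw [hfirst]; exact h.mem
  · rw [hfirst, hflag]; exact h.flag

theorem of_frame {R D : Finset ℕ} {s' : Store} (h : Tally V s.real) (hf : Frame R D s s')
    (hfirst : Arr.first ∉ D := by decide) (hflag : Arr.flag ∉ D := by decide) : Tally V s'.real :=
  h.congr (hf.real_eq _ hfirst) (hf.real_eq _ hflag)

theorem empty (hfirst : ∀ j k : Fin n, m Arr.first j k = 0) (hflag : m Arr.flag 0 0 ≠ 0) :
    Tally (∅ : Set (Fin n × Fin n × ℝ≥0)) m :=
  ⟨fun _ _ _ _ h => h.elim, fun j k h => (h (hfirst j k)).elim,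
    fun _ _ _ _ h => h.elim, fun _ => hflag⟩

theorem insert_of_eq (h : Tally V m) (hx : x = 0 ∨ x = m Arr.first j k) :
    Tally (insert (j, k, x) V) m := by
  refine ⟨fun j' k' x' h0 hx' => ?_, fun j' k' h0 => Or.inr (h.mem h0), h.flag.trans
    ⟨fun h' j' k' x' hx' h0 => ?_, fun h' j' k' x' hx' => h' (Or.inr hx')⟩⟩
  · rcases hx' with he | hx'
    · cases he
      exact hx.elim id fun hx => hx.trans h0
    · exact h.eq_zero h0 hx'
  · rcases hx' with he | hx'
    · cases he
      exact hx.resolve_left h0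
    · exact h' hx' h0

theorem insert_of_ne (h : Tally V m) (h0 : m Arr.first j k ≠ 0) (hx : x ≠ 0)
    (hne : x ≠ m Arr.first j k) (hfirst : m' Arr.first = m Arr.first)
    (hflag : m' Arr.flag 0 0 = 0) : Tally (insert (j, k, x) V) m' := by
  refine ⟨fun j' k' x' h0' hx' => ?_, fun j' k' h0' => Or.inr ?_,
    iff_of_false (not_not.2 hflag) fun h' => ?_⟩
  · rw [hfirst] at h0'
    rcases hx' with he | hx'
    · cases he
      exact absurd h0' h0
    · exact h.eq_zero h0' hx'
  · rw [hfirst] at h0' ⊢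
    exact h.mem h0'
  · exact hne (hfirst ▸ h' (Set.mem_insert _ _) hx)

theorem insert_of_new (h : Tally V m) (h0 : m Arr.first j k = 0) (hx : x ≠ 0)
    (hfirst : m' Arr.first = setEntry (m Arr.first) j k x) (hflag : m' Arr.flag = m Arr.flag) :
    Tally (insert (j, k, x) V) m' := by
  have hself : m' Arr.first j k = x := by rw [hfirst, setEntry_self]
  have hother (j' k' : Fin n) (hne : ¬ (j' = j ∧ k' = k)) :
      m' Arr.first j' k' = m Arr.first j' k' := by
    rw [hfirst, setEntry_of_ne _ _ (by simpa [Fin.ext_iff] using hne)]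
  have hV (x' : ℝ≥0) (hx' : (j, k, x') ∈ V) : x' = 0 := h.eq_zero h0 hx'
  refine ⟨fun j' k' x' h0' hx' => ?_, fun j' k' h0' => ?_, ?_⟩
  · grind [h.eq_zero (j := j') (k := k') (x := x')]
  · grind [h.mem (j := j') (k := k')]
  · rw [hflag, h.flag]
    refine ⟨fun h' j' k' x' hx' hx0 => ?_, fun h' j' k' x' hx' hx0 => ?_⟩ <;> grind

theorem flag_ne_zero_iff (h : Tally V m) : m Arr.flag 0 0 ≠ 0 ↔
    ∀ ⦃j k x y⦄, (j, k, x) ∈ V → (j, k, y) ∈ V → x ≠ 0 → y ≠ 0 → x = y := by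
  rw [h.flag]
  refine ⟨fun h' j k x y hx hy hx0 hy0 => (h' hx hx0).trans (h' hy hy0).symm,
    fun h' j k x hx hx0 => ?_⟩
  have h0 : m Arr.first j k ≠ 0 := fun h0 => hx0 (h.eq_zero h0 hx)
  exact h' hx (h.mem h0) hx0 h0

end Tally

/-- Record the maximum of the entries `row, col` and `row, mid` of `Arr.mean` for the columns `col`
and `mid`. -/
def Prog.checkEntry : Prog :=
  .seq (.op (.realMax (.scalar Arr.tmp) ⟨Arr.mean, Reg.row, Reg.col⟩
    ⟨Arr.mean, Reg.row, Reg.mid⟩)) <|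
    .ite (.realLe (.scalar Arr.tmp) (.scalar Arr.zero)) .skip <|
    .ite (.realLe ⟨Arr.first, Reg.col, Reg.mid⟩ (.scalar Arr.zero))
      (.op (.realCopy ⟨Arr.first, Reg.col, Reg.mid⟩ (.scalar Arr.tmp))) <|
    .ite (.realLe (.scalar Arr.tmp) ⟨Arr.first, Reg.col, Reg.mid⟩)
      (.ite (.realLe ⟨Arr.first, Reg.col, Reg.mid⟩ (.scalar Arr.tmp)) .skip
        (.op (.realZero (.scalar Arr.flag))))
      (.op (.realZero (.scalar Arr.flag)))

theorem run_checkEntry (hs : Ready n s) {W : Matrix (Fin n) (Fin n) ℝ≥0}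
    (hW : Holds s.real Arr.mean W) {V : Set (Fin n × Fin n × ℝ≥0)} (hV : Tally V s.real)
    {i j k : Fin n} (hi : s.reg Reg.row = i) (hj : s.reg Reg.col = j) (hk : s.reg Reg.mid = k) :
    Run ∅ {Arr.first, Arr.flag, Arr.tmp} .checkEntry 6 s
      (Tally (insert (j, k, max (W i j) (W i k)) V)) := by
  generalize hx : max (W i j) (W i k) = x
  refine ((run_scalarOp (a := Arr.tmp) hs.zero (v := x) (by
    simp only [Instr.apply, Store.getReal, hi, hj, hk, hW i j, hW i k, hx])).seq (R' := ∅)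
    (D' := {Arr.first, Arr.flag}) (k' := 5) fun s₁ f₁ h₁ => ?_).weaken le_rfl
  have hs₁ := hs.of_frame f₁
  have hV₁ := hV.of_frame f₁
  have hj₁ := (f₁.reg_eq Reg.col).trans hj
  have hk₁ := (f₁.reg_eq Reg.mid).trans hk
  have htmp : s₁.getReal (.scalar Arr.tmp) = x := by rw [Store.getReal, hs₁.zero, h₁]
  have hzero : s₁.getReal (.scalar Arr.zero) = 0 := by rw [Store.getReal, hs₁.zero, hs₁.real_zero]
  have hfirst : s₁.getReal ⟨Arr.first, Reg.col, Reg.mid⟩ = s₁.real Arr.first j k := by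
    rw [Store.getReal, hj₁, hk₁]
  have hclear (h0 : s₁.real Arr.first j k ≠ 0) (hx0 : x ≠ 0) (hne : x ≠ s₁.real Arr.first j k) :
      Run ∅ {Arr.first, Arr.flag} (.op (.realZero (.scalar Arr.flag))) 1 s₁
        (Tally (insert (j, k, x) V)) :=
    ((run_scalarOp (a := Arr.flag) hs₁.zero rfl).imp fun s₂ f₂ h₂ =>
      hV₁.insert_of_ne h0 hx0 hne (f₂.real_eq _) h₂).weaken le_rfl
  refine Run.ite (k := 4) (fun hx0 => run_skip (by decide) (hV₁.insert_of_eq (Or.inl ?_)))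
    fun hx0 => ?_
  · rwa [Test.Holds, htmp, hzero, nonpos_iff_eq_zero] at hx0
  rw [Test.Holds, htmp, hzero, nonpos_iff_eq_zero] at hx0
  refine Run.ite (k := 3) (fun h0 => ?_) fun h0 => ?_ <;>
    rw [Test.Holds, hfirst, hzero, nonpos_iff_eq_zero] at h0
  · exact ((Run.realOp (a := Arr.first) (by rw [Instr.apply, htmp]) hj₁ hk₁).imp fun s₂ f₂ h₂ =>
      hV₁.insert_of_new h0 hx0 h₂ (f₂.real_eq _)).weaken (by decide)
  refine Run.ite (k := 2) (fun hle => Run.ite (k := 1) (fun hge => run_skip le_rfl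
    (hV₁.insert_of_eq (Or.inr ?_))) fun hge => hclear h0 hx0 ?_) fun hle =>
    (hclear h0 hx0 ?_).weaken (by decide) <;>
  simp only [Test.Holds, htmp, hfirst] at hle
  · exact le_antisymm hle (by simpa only [Test.Holds, htmp, hfirst] using hge)
  · exact fun h => hge (by simpa only [Test.Holds, htmp, hfirst] using h.ge)
  · exact fun h => hle h.le

/-- The values of the pairs of columns in the rows with index in `S` of the matrix `W`, as far as
they belong to nodes on cycles of `A`. -/
def cycleRowValues (A W : Matrix (Fin n) (Fin n) ℝ≥0) (S : Finset (Fin n)) :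
    Set (Fin n × Fin n × ℝ≥0) :=
  {p | ∃ v ∈ S, nodeMeanPow A v ≠ 0 ∧ max (W v p.1) (W v p.2.1) = p.2.2}

theorem cycleRowValues_insert (A W : Matrix (Fin n) (Fin n) ℝ≥0) (S : Finset (Fin n)) (v : Fin n) :
    cycleRowValues A W (insert v S) = cycleRowValues A W S ∪
      {p | nodeMeanPow A v ≠ 0 ∧ max (W v p.1) (W v p.2.1) = p.2.2} := by
  ext p
  simp only [cycleRowValues, Finset.exists_mem_insert, Set.mem_union, Set.mem_ofPred_eq]
  exact or_comm

/-- Record the values in the row `row` of `Arr.mean`. -/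
def Prog.checkRow : Prog := .forPairs Reg.col Reg.mid Reg.order .checkEntry

theorem run_checkRow (hs : Ready n s) {W : Matrix (Fin n) (Fin n) ℝ≥0}
    (hW : Holds s.real Arr.mean W) {V : Set (Fin n × Fin n × ℝ≥0)} (hV : Tally V s.real)
    {i : Fin n} (hi : s.reg Reg.row = i) :
    Run {Reg.col, Reg.mid} {Arr.first, Arr.flag, Arr.tmp} .checkRow (pairsCost n 6) s
      (Tally (V ∪ {p | max (W i p.1) (W i p.2.1) = p.2.2})) := by
  let value (p : Fin n × Fin n) : Fin n × Fin n × ℝ≥0 := (p.1, p.2, max (W i p.1) (W i p.2))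
  have hrange : {p : Fin n × Fin n × ℝ≥0 | max (W i p.1) (W i p.2.1) = p.2.2} =
      value '' (Finset.univ : Finset (Fin n × Fin n)) := by
    ext ⟨j, k, x⟩
    simp [value]
  rw [hrange]
  refine Run.forPairs (R := ∅) hs.order (by decide) (by decide) (by decide)
    (fun Z => Tally (V ∪ value '' Z)) (by simpa using hV) fun Z j k _ s₁ f₁ hj hk h₁ => ?_
  rw [Finset.coe_insert, Set.image_insert_eq, Set.union_insert]
  exact run_checkEntry (hs.of_frame f₁) (hW.of_frame f₁) h₁ ((f₁.reg_eq _).trans hi) hj hk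

/-- Record the values in the rows of `Arr.mean` that belong to nodes on cycles. -/
def Prog.checkMat : Prog :=
  .forLoop Reg.row Reg.order <|
    .ite (.realLe ⟨Arr.nodeMean, Reg.row, Reg.zero⟩ (.scalar Arr.zero)) .skip .checkRow

/-- Number of operations of `Prog.checkMat`. -/
abbrev checkMatCost (n : ℕ) : ℕ := forCost n (1 + pairsCost n 6)

theorem run_checkMat (hs : Ready n s) (hmean : HoldsVec s.real Arr.nodeMean (nodeMeanPow A))
    {W : Matrix (Fin n) (Fin n) ℝ≥0} (hW : Holds s.real Arr.mean W)
    {V : Set (Fin n × Fin n × ℝ≥0)} (hV : Tally V s.real) :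
    Run {Reg.row, Reg.col, Reg.mid} {Arr.first, Arr.flag, Arr.tmp} .checkMat (checkMatCost n) s
      (Tally (V ∪ cycleRowValues A W Finset.univ)) := by
  refine Run.forFin (R := {Reg.col, Reg.mid}) hs.order (by decide) (by decide)
    (fun S => Tally (V ∪ cycleRowValues A W S)) (by simpa [cycleRowValues] using hV)
    fun S v _ s₁ f₁ hv h₁ => ?_
  have hs₁ := hs.of_frame f₁
  have htest : Test.Holds (.realLe ⟨Arr.nodeMean, Reg.row, Reg.zero⟩ (.scalar Arr.zero)) s₁ ↔
      nodeMeanPow A v = 0 := by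
    simp only [Test.Holds, Store.getReal, hv, hs₁.zero, hs₁.real_zero,
      hmean.of_frame f₁ (by decide) v, nonpos_iff_eq_zero]
  rw [cycleRowValues_insert, ← Set.union_assoc]
  refine Run.ite (fun h => run_skip ?_ ?_) fun h => ?_
  · exact Nat.le_add_left 1 _
  · simpa [htest.1 h] using h₁
  · simpa [htest.not.1 h] using run_checkRow hs₁ (hW.of_frame f₁) h₁ hv

/-- Record the values for the walks of the present length and the next ones, as many lengths as the
order says. -/
def Prog.checkPhase : Prog :=
  .seq (.op (.realOne (.scalar Arr.flag))) <|
  .forLoop Reg.round Reg.order <| .seq .checkMat (.extendWalks Arr.reachOne Arr.meanOne)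

/-- Number of operations of `Prog.checkPhase`. -/
abbrev checkCost (n : ℕ) : ℕ := 1 + forCost n (checkMatCost n + extendWalksCost n)

theorem run_checkPhase (hs : Ready n s) (hmean : HoldsVec s.real Arr.nodeMean (nodeMeanPow A))
    (h0 : Holds s.real Arr.first (0 : Matrix (Fin n) (Fin n) ℝ≥0))
    (hone : HoldsWalks A 1 s.real Arr.reachOne Arr.meanOne) {T : ℕ}
    (hT : HoldsWalks A T s.real Arr.reach Arr.mean) :
    Run {Reg.row, Reg.col, Reg.mid, Reg.round}
      {Arr.reach, Arr.mean, Arr.reachNext, Arr.meanNext, Arr.first, Arr.flag, Arr.tmp} .checkPhase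
      (checkCost n) s
      (Tally (⋃ t ∈ Finset.range n, cycleRowValues A (walkMeanPow A (T + t)) Finset.univ)) := by
  refine ((run_scalarOp (a := Arr.flag) hs.zero rfl).seq fun s₁ f₁ h₁ => (Run.forLoop
    (R := {Reg.row, Reg.col, Reg.mid})
    (D := {Arr.reach, Arr.mean, Arr.reachNext, Arr.meanNext, Arr.first, Arr.flag, Arr.tmp})
    (hs.of_frame f₁).order (by decide) (by decide)
    (fun x m => HoldsWalks A (T + x) m Arr.reach Arr.mean ∧
      Tally (⋃ t ∈ Finset.range x, cycleRowValues A (walkMeanPow A (T + t)) Finset.univ) m)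
    ⟨hT.of_frame f₁, ?_⟩ fun x _ s₂ f₂ _ h₂ => ?_).imp fun s' _ h => h.2).weaken le_rfl
  · simpa using Tally.empty (h0.of_frame f₁) (h₁.trans_ne one_ne_zero)
  · have hs₂ := (hs.of_frame f₁).of_frame f₂
    refine ((run_checkMat hs₂ ((hmean.of_frame f₁).of_frame f₂) h₂.1.2 h₂.2).seq fun s₃ f₃ h₃ =>
      (run_extendWalks (hs₂.of_frame f₃) (h₂.1.of_frame f₃)
        (((hone.of_frame f₁).of_frame f₂).of_frame f₃)).imp fun s₄ f₄ h₄ =>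
      ⟨h₄, ?_⟩).weaken le_rfl
    rw [Finset.range_add_one, Finset.set_biUnion_insert, Set.union_comm]
    exact h₃.of_frame f₄

end Check

section Main

variable {n : ℕ}

theorem two_mul_sq_le (n : ℕ) : 2 * n ^ 2 ≤ 8 ^ n := by
  calc 2 * n ^ 2 ≤ 2 ^ n * (2 ^ n) ^ 2 := by
        rcases n.eq_zero_or_pos with rfl | hn
        · simp
        · have := Nat.lt_two_pow_self (n := n)
          have := Nat.le_self_pow hn.ne' 2
          gcongr
    _ = 8 ^ n := by rw [← pow_succ', ← pow_mul, mul_comm, pow_mul]; norm_num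

theorem forall_constOnSupport_iff_flag_ne_zero {A : Matrix (Fin n) (Fin n) ℝ≥0} {T : ℕ}
    {m : RealArrays} (h : Tally
      (⋃ t ∈ Finset.range n, cycleRowValues A (walkMeanPow A (T + t)) Finset.univ) m) :
    (∀ j k, ConstOnSupport fun p : {v // nodeMeanPow A v ≠ 0} × Fin n =>
      max (walkMeanPow A (T + p.2) p.1 j) (walkMeanPow A (T + p.2) p.1 k)) ↔
      m Arr.flag 0 0 ≠ 0 := by
  have hmem (j k : Fin n) (x : ℝ≥0) :
      (j, k, x) ∈ ⋃ t ∈ Finset.range n, cycleRowValues A (walkMeanPow A (T + t)) Finset.univ ↔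
        ∃ p : {v // nodeMeanPow A v ≠ 0} × Fin n,
          max (walkMeanPow A (T + p.2) p.1 j) (walkMeanPow A (T + p.2) p.1 k) = x := by
    simp only [cycleRowValues, Set.mem_iUnion₂, Finset.mem_range, Finset.mem_univ, true_and,
      Set.mem_ofPred_eq, Prod.exists, Subtype.exists, exists_prop]
    exact ⟨fun ⟨t, ht, v, hv, hx⟩ => ⟨v, hv, ⟨t, ht⟩, hx⟩,
      fun ⟨v, hv, t, hx⟩ => ⟨t, t.2, v, hv, hx⟩⟩
  rw [h.flag_ne_zero_iff]
  simp only [hmem]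
  refine forall₂_congr fun j k => ⟨?_, fun h' p q hp hq => h' ⟨p, rfl⟩ ⟨q, rfl⟩ hp hq⟩
  rintro h' _ _ ⟨p, rfl⟩ ⟨q, rfl⟩ hp hq
  exact h' hp hq

/-- Decide whether the input is orbit periodic. -/
def Prog.decideOrbitPeriodic : Prog :=
  .seq (.seq .nodeMeanPhase <| .seq .walksOne <| .seq .squarePhase .checkPhase) <|
  .ite (.realLe (.scalar Arr.flag) (.scalar Arr.zero)) (.op (.zero Reg.order))
    (.seq (.op (.zero Reg.order)) (.op (.succ Reg.order)))

/-- Number of operations of the four phases of `Prog.decideOrbitPeriodic`. -/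
abbrev phasesCost (n : ℕ) : ℕ := nodeMeanCost n + (walksOneCost n + (squareCost n + checkCost n))

theorem run_phases (A : Matrix (Fin n) (Fin n) ℝ≥0) :
    Run {Reg.row, Reg.col, Reg.mid, Reg.round, Reg.factor, Reg.repeat}
      {Arr.power, Arr.powerNext, Arr.nodeMean, Arr.acc, Arr.base, Arr.tmp, Arr.reachOne,
        Arr.meanOne, Arr.reach, Arr.mean, Arr.reachNext, Arr.meanNext, Arr.first, Arr.flag}
      (.seq .nodeMeanPhase <| .seq .walksOne <| .seq .squarePhase .checkPhase) (phasesCost n)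
      (inputStore A) fun m => m Arr.flag 0 0 ≠ 0 ↔ OrbitPeriodic A := by
  have hs : Ready n (inputStore A) := ⟨rfl, rfl, rfl⟩
  have hA : Holds (inputStore A).real Arr.input A := fun i j => dif_pos ⟨rfl, i.2, j.2⟩
  have hfirst : Holds (inputStore A).real Arr.first (0 : Matrix (Fin n) (Fin n) ℝ≥0) :=
    fun _ _ => rfl
  refine ((run_nodeMeanPhase hs hA fun _ => rfl).seq fun s₁ f₁ h₁ =>
    (run_walksOne (hs.of_frame f₁) (hA.of_frame f₁) h₁).seq fun s₂ f₂ h₂ =>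
    (run_squarePhase ((hs.of_frame f₁).of_frame f₂) h₂.2).seq fun s₃ f₃ h₃ =>
    (run_checkPhase (((hs.of_frame f₁).of_frame f₂).of_frame f₃)
      ((h₁.of_frame f₂).of_frame f₃) (((hfirst.of_frame f₁).of_frame f₂).of_frame f₃)
      (h₂.1.of_frame f₃) h₃).imp fun s₄ _ h₄ => ?_).weaken le_rfl
  rw [orbitPeriodic_iff_walkMeanPow (two_mul_sq_le n), forall_constOnSupport_iff_flag_ne_zero h₄]

theorem exec_decideOrbitPeriodic (A : Matrix (Fin n) (Fin n) ℝ≥0) :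
    ∃ t s, Exec .decideOrbitPeriodic (inputStore A) t s ∧ s.Answers (OrbitPeriodic A) ∧
      t ≤ phasesCost n + 3 := by
  obtain ⟨t, s, he, ht, hf, hflag⟩ := run_phases A
  have hs : Ready n s := Ready.of_frame (s := inputStore A) ⟨rfl, rfl, rfl⟩ hf
  have htest : Test.Holds (.realLe (.scalar Arr.flag) (.scalar Arr.zero)) s ↔
      ¬ OrbitPeriodic A := by
    simp only [Test.Holds, Store.getReal, hs.zero, hs.real_zero, nonpos_iff_eq_zero, ← hflag,
      not_not]
  by_cases h : Test.Holds (.realLe (.scalar Arr.flag) (.scalar Arr.zero)) s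
  · exact ⟨_, _, he.seq (.iteTrue h (.op _ _)), Or.inr ⟨htest.1 h, rfl⟩, by omega⟩
  · exact ⟨_, _, he.seq (.iteFalse h (.seq (.op _ _) (.op _ _))),
      Or.inl ⟨not_not.1 (htest.not.1 h), rfl⟩, by omega⟩

theorem phasesCost_le (hn : 1 ≤ n) : phasesCost n + 3 ≤ 1000 * n ^ 4 := by
  have h0 : 1 ≤ n ^ 4 := Nat.one_le_pow _ _ hn
  have h1 : n ≤ n ^ 4 := Nat.le_self_pow (by decide) n
  have h2 : n ^ 2 ≤ n ^ 4 := Nat.pow_le_pow_right hn (by decide)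
  have h3 : n ^ 3 ≤ n ^ 4 := Nat.pow_le_pow_right hn (by decide)
  simp only [phasesCost, nodeMeanCost, walksOneCost, squareCost, checkCost, checkMatCost,
    extendWalksCost, matMulCost, mulAccCost, updateNodeMeansCost, updateNodeMeanCost,
    raiseFactorialCost, raiseCost, pairsCost, forCost]
  ring_nf
  linarith

theorem natCast_le_mul_pow_mul_log {d t K : ℕ} (hn : 2 ≤ n) (ht : t ≤ K * n ^ d) :
    (t : ℝ) ≤ K / Real.log 2 * ((n : ℝ) ^ d * Real.log n) := by
  have h2 : 0 < Real.log 2 := Real.log_pos one_lt_two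
  have hlog : Real.log 2 ≤ Real.log n := Real.log_le_log two_pos (by exact_mod_cast hn)
  have ht' : (t : ℝ) ≤ K * (n : ℝ) ^ d := by exact_mod_cast ht
  refine ht'.trans ?_
  rw [div_mul_eq_mul_div, le_div_iff₀ h2, ← mul_assoc]
  exact mul_le_mul_of_nonneg_left hlog (by positivity)

end Main

end MaxAlg

theorem corollary7p7_general :
    ∃ (P : MaxAlg.Prog) (K : ℕ), ∀ (n : ℕ) (A : Matrix (Fin n) (Fin n) ℝ≥0),
      ∃ (t : ℕ) (s : MaxAlg.Store),
        MaxAlg.Exec P (MaxAlg.inputStore A) t s ∧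
        s.Answers (MaxAlg.OrbitPeriodic A) ∧
        (1 ≤ n → t ≤ K * n ^ 4) := by
  refine ⟨.decideOrbitPeriodic, 1000, fun n A => ?_⟩
  obtain ⟨t, s, he, ha, ht⟩ := MaxAlg.exec_decideOrbitPeriodic A
  exact ⟨t, s, he, ha, fun hn => ht.trans (MaxAlg.phasesCost_le hn)⟩

theorem corollary7p7 :
    ∃ (P : MaxAlg.Prog) (K : ℝ), ∀ (n : ℕ) (A : Matrix (Fin n) (Fin n) ℝ≥0),
      ∃ (t : ℕ) (s : MaxAlg.Store),
        MaxAlg.Exec P (MaxAlg.inputStore A) t s ∧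
        s.Answers (MaxAlg.OrbitPeriodic A) ∧
        (2 ≤ n → (t : ℝ) ≤ K * ((n : ℝ) ^ 4 * Real.log n)) := by
  obtain ⟨P, K, h⟩ := corollary7p7_general
  refine ⟨P, K / Real.log 2, fun n A => ?_⟩
  obtain ⟨t, s, he, ha, ht⟩ := h n A
  exact ⟨t, s, he, ha, fun hn => MaxAlg.natCast_le_mul_pow_mul_log hn (ht (one_le_two.trans hn))⟩
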